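/- Let $K$ be a field of characteristic $0$, let $F=K(t)$, and let $\Lambda=F[p_1,p_2,\dots]$ be the ring of symmetric functions in $X=x_1+x_2+\cdots$ with coefficients in $F$. Let $h_r$ be the complete symmetric functions ($h_r=0$ for $r<0$), let $s_\lambda=\det(h_{\lambda_i+j-i})_{1\le i,j\le\ell(\lambda)}$ be the Schur functions, and let $f^\perp$ be the adjoint of multiplication by $f$ for the scalar product $\langle p_\lambda,p_\mu\rangle=\delta_{\lambda\mu}z_\lambda$. For $\ell\in\mathbb Z$ put $$B_\ell=\sum_{i\ge 0}h_{i+\ell}[X]\,h_i[X(t-1)]^{\perp},$$ where $f\mapsto f[X(t-1)]$ is the $F$-algebra map with $p_r\mapsto(t^r-1)p_r$. For a partition $\lambda$ with $m$ parts put $$B_\lambda=\prod_{1\le i<j\le m}(1-t\,e_{ij})\;B_{\lambda_1}\cdots B_{\lambda_m},$$ where $e_{ij}$ raises the $i$-th index of the formal product $B_{\lambda_1}\cdots B_{\lambda_m}$ by one and lowers its $j$-th index by one. Let $k$ be a natural number. A partition $\lambda$ is $k$-bounded if $\lambda_1\le k$. The main hook-length $h_M(\lambda)$ is the hook-length $\lambda_1+\ell(\lambda)-1$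 of the corner cell of the diagram of $\lambda$ (and $0$ if $\lambda$ is empty). The $k$-split $(\lambda^{(1)},\dots,\lambda^{(r)})$ of a $k$-bounded $\lambda$ is obtained by cutting the sequence of parts of $\lambda$, in order, into consecutive partitions with $h_M(\lambda^{(i)})=k$ for $i<r$ and $h_M(\lambda^{(r)})\le k$. Put $$G^{(k)}_\lambda[X;t]=B_{\lambda^{(1)}}\cdots B_{\lambda^{(r)}}\cdot 1 .$$ Let $\Lambda^{(k)}_t$ be the $F$-span of the Hall-Littlewood functions $H_\lambda[X;t]=B_{\lambda_1}\cdots B_{\lambda_{\ell(\lambda)}}\cdot 1$ with $\lambda$ a $k$-bounded partition. The $G^{(k)}_\lambda[X;t]$, $\lambda$ $k$-bounded, form a basis of $\Lambda^{(k)}_t$; let $\bar T^{(k)}_j$ be the linear operator on $\Lambda^{(k)}_t$ that fixes $G^{(k)}_\lambda[X;t]$ if $\lambda_1=j$ and sends it to $0$ otherwise. The $k$-Schur functions are defined for $k$-bounded $\lambda$ by $s^{(k)}_{()}[X;t]=1$ and $$s^{(k)}_\lambda[X;t]=\bar T^{(k)}_{\lambda_1}B_{\lambda_1}\,s^{(k)}_{(\lambda_2,\lambda_3,\dots)}[X;t].$$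 **Statement.** For every $k$-bounded partition $\lambda$ with main hook-length $h_M(\lambda)\le k$, $$s^{(k)}_\lambda[X;t]=s_\lambda[X].$$ -/

import Mathlib

namespace KSchur

open MvPolynomial

/-! ## Partitions -/

/-- A partition, written as the finite list of its (nonzero) parts in weakly decreasing order. -/
def IsPartition (l : List ℕ) : Prop :=
  l.Pairwise (fun a b => b ≤ a) ∧ ∀ a ∈ l, 0 < a

/-- The first (largest) part `λ₁`; it is `0` for the empty partition. -/
def firstPart (l : List ℕ) : ℕ := l.headD 0

/-- A partition is `k`-bounded if its first part is at most `k`. -/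
def IsBounded (k : ℕ) (l : List ℕ) : Prop := IsPartition l ∧ firstPart l ≤ k

/-- The hook-length of the corner cell of the diagram: its arm `λ₁ - 1`, plus its leg `ℓ(λ) - 1`,
plus one. The empty partition has no cell, and gets the value `0`. -/
def mainHook : List ℕ → ℕ
  | [] => 0
  | a :: l => (a - 1) + l.length + 1

/-- The `k`-split of a `k`-bounded partition: cut off, from the first row on, pieces of main
hook-length `k`. A piece with first part `a` and main hook-length `k` has `k - a + 1` rows; the last
piece takes what is left. -/
def kSplit (k : ℕ) : List ℕ → List (List ℕ)
  | [] => []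
  | a :: l => (a :: l.take (k - a)) :: kSplit k (l.drop (k - a))
termination_by l => l.length
decreasing_by simp only [List.length_drop, List.length_cons]; omega

/-- The pieces of the `k`-split, put together again, are the partition. -/
theorem kSplit_flatten (k : ℕ) (l : List ℕ) : (kSplit k l).flatten = l := by
  induction l using kSplit.induct (k := k) with
  | case1 => simp [kSplit]
  | case2 a l ih => simp [kSplit, ih]

/-- No piece of the `k`-split has main hook-length above `k`. -/
theorem mainHook_le_of_mem_kSplit {k : ℕ} {l : List ℕ} (hl : ∀ a ∈ l, 0 < a ∧ a ≤ k) :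
    ∀ p ∈ kSplit k l, mainHook p ≤ k := by
  induction l using kSplit.induct (k := k) with
  | case1 => simp [kSplit]
  | case2 a l ih =>
    intro p hp
    rw [kSplit, List.mem_cons] at hp
    rcases hp with rfl | hp
    · have := hl a (by simp)
      simp only [mainHook, List.length_take]
      omega
    · exact ih (fun b hb => hl b (by simp [List.mem_of_mem_drop hb])) p hp

/-- All pieces of the `k`-split but the last one have main hook-length exactly `k`. -/
theorem mainHook_eq_of_mem_dropLast_kSplit {k : ℕ} {l : List ℕ} (hl : ∀ a ∈ l, 0 < a ∧ a ≤ k) :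
    ∀ p ∈ (kSplit k l).dropLast, mainHook p = k := by
  induction l using kSplit.induct (k := k) with
  | case1 => simp [kSplit]
  | case2 a l ih =>
    intro p hp
    rw [kSplit] at hp
    rcases hd : l.drop (k - a) with _ | ⟨b, m⟩
    · rw [hd] at hp
      simp [kSplit] at hp
    · have hne : kSplit k (l.drop (k - a)) ≠ [] := by rw [hd, kSplit]; simp
      rw [List.dropLast_cons_of_ne_nil hne, List.mem_cons] at hp
      rcases hp with rfl | hp
      · have h1 := hl a (by simp)
        have h2 : (l.drop (k - a)).length = m.length + 1 := by rw [hd]; rfl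
        rw [List.length_drop] at h2
        simp only [mainHook, List.length_take]
        omega
      · exact ih (fun b hb => hl b (by simp [List.mem_of_mem_drop hb])) p hp

/-! ## Symmetric functions -/

/-- The ring of symmetric functions over a field `F` of characteristic zero (in infinitely many
variables), as the ring freely generated by the power sums: the variable `X r` is `p_r`, for
`r = 1, 2, …`. A monomial `a : ℕ+ →₀ ℕ` is the product `p_λ` where `λ` has `a r` parts equal
to `r`. -/
abbrev SymFun (F : Type*) [Field F] := MvPolynomial ℕ+ F

/-- The value `f(x_1, …, x_N)` of a symmetric function in finitely many variables `x_i`, `i : σ`. -/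
noncomputable def realize (F : Type*) [Field F] (σ : Type*) [Fintype σ] :
    SymFun F →ₐ[F] MvPolynomial σ F :=
  aeval fun r : ℕ+ => MvPolynomial.psum σ F r

/-- The complete symmetric functions `h_n`, determined by `h_0 = 1` and
`n h_n = p_1 h_{n-1} + p_2 h_{n-2} + ⋯ + p_n h_0`. -/
noncomputable def completeNat (F : Type*) [Field F] : ℕ → SymFun F
  | 0 => 1
  | n + 1 => C ((n + 1 : F)⁻¹) *
      ∑ i : Fin (n + 1), X (i : ℕ).succPNat * completeNat F (n - i)
decreasing_by omega

theorem coeff_hsymm {F : Type*} [Field F] {σ : Type*} [Fintype σ] [DecidableEq σ] (n : ℕ)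
    (d : σ →₀ ℕ) : coeff d (hsymm σ F n) = if d.degree = n then 1 else 0 := by
  have h1 : ∀ s : Sym σ n, ((s : Multiset σ).map (X : σ → MvPolynomial σ F)).prod =
      monomial (Multiset.toFinsupp (s : Multiset σ)) 1 := by
    intro s
    induction (s : Multiset σ) using Multiset.induction_on with
    | empty => simp
    | cons a m ih =>
      rw [Multiset.map_cons, Multiset.prod_cons, ih, X, monomial_mul, one_mul,
        ← Multiset.singleton_add, map_add, Multiset.toFinsupp_singleton]
  have h2 : hsymm σ F n =
      ∑ s : Sym σ n, monomial (Multiset.toFinsupp (s : Multiset σ)) (1 : F) :=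
    Finset.sum_congr rfl fun s _ => h1 s
  rw [h2, coeff_sum]
  simp only [coeff_monomial]
  have hdeg : d.degree = Multiset.card (Finsupp.toMultiset d) := by
    rw [Finsupp.card_toMultiset, Finsupp.degree]; rfl
  split_ifs with hd
  · obtain ⟨s₀, hs₀⟩ : ∃ s₀ : Sym σ n, (s₀ : Multiset σ) = Finsupp.toMultiset d :=
      ⟨Sym.mk (Finsupp.toMultiset d) (by rw [← hdeg, hd]), rfl⟩
    have h3 : ∀ s : Sym σ n, Multiset.toFinsupp (s : Multiset σ) = d ↔ s = s₀ := by
      intro s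
      rw [← Sym.coe_inj, hs₀]
      constructor
      · rintro rfl
        rw [Multiset.toFinsupp_toMultiset]
      · intro h
        rw [h, Finsupp.toMultiset_toFinsupp]
    simp only [h3, Finset.sum_ite_eq', Finset.mem_univ, if_true]
  · refine Finset.sum_eq_zero fun s _ => ?_
    rw [if_neg]
    rintro rfl
    apply hd
    rw [hdeg]
    simp

/-- In finitely many variables, `h_n` is the sum of all monomials of degree `n`. -/
theorem realize_completeNat (F : Type*) [Field F] [CharZero F] (σ : Type*) [Fintype σ]
    [DecidableEq σ] (n : ℕ) : realize F σ (completeNat F n) = hsymm σ F n := by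
  induction n using Nat.strong_induction_on with
  | _ n ih =>
    rcases n with _ | n
    · simp [completeNat]
    · have hC : ∀ c : F, realize F σ (C c) = C c := by
        intro c; rw [realize, aeval_C]; rfl
      rw [completeNat, map_mul, hC, map_sum]
      have hne : (n + 1 : F) ≠ 0 := by exact_mod_cast Nat.succ_ne_zero n
      ext d
      rw [coeff_C_mul, inv_mul_eq_iff_eq_mul₀ hne, coeff_sum, coeff_hsymm]
      have hterm : ∀ i : Fin (n + 1),
          coeff d (realize F σ (X (i : ℕ).succPNat * completeNat F (n - i))) =
          ∑ x : σ, if (i : ℕ) + 1 ≤ d x ∧ d.degree = n + 1 then (1 : F) else 0 := by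
        intro i
        rw [map_mul, ih _ (by omega), realize, aeval_X, MvPolynomial.psum, Finset.sum_mul,
          coeff_sum]
        refine Finset.sum_congr rfl fun x _ => ?_
        rw [X_pow_eq_monomial, coeff_monomial_mul', one_mul, coeff_hsymm, Nat.succPNat_coe]
        simp only [Finsupp.single_le_iff]
        by_cases hx : (i : ℕ) + 1 ≤ d x
        · have hs : (d - Finsupp.single x ((i : ℕ) + 1)).degree + ((i : ℕ) + 1) = d.degree := by
            conv_rhs => rw [← tsub_add_cancel_of_le (Finsupp.single_le_iff.mpr hx)]
            rw [map_add, Finsupp.degree_single]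
          have hi := i.2
          have he : (d - Finsupp.single x ((i : ℕ) + 1)).degree = n - i ↔ d.degree = n + 1 := by
            omega
          rw [if_pos hx]
          simp only [he, hx, true_and]
        · simp [hx]
      simp only [hterm]
      rw [Finset.sum_comm]
      by_cases hd : d.degree = n + 1
      · have hcount : ∀ x : σ,
            (∑ i : Fin (n + 1), if (i : ℕ) + 1 ≤ d x ∧ d.degree = n + 1 then (1 : F) else 0) =
              (d x : F) := by
          intro x
          have hx : d x ≤ n + 1 := hd ▸ Finsupp.le_degree x d
          rw [Fin.sum_univ_eq_sum_range
            (fun i => if i + 1 ≤ d x ∧ d.degree = n + 1 then (1 : F) else 0) (n + 1),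
            Finset.sum_boole]
          congr 1
          have : (Finset.range (n + 1)).filter (fun i => i + 1 ≤ d x ∧ d.degree = n + 1) =
              Finset.range (d x) := by
            ext i
            simp only [Finset.mem_filter, Finset.mem_range]
            omega
          rw [this, Finset.card_range]
        simp only [hcount]
        rw [if_pos hd, mul_one, ← Nat.cast_sum, ← Finsupp.degree_eq_sum, hd]
        push_cast
        ring
      · simp [hd]

/-- `h_r` for all integers `r`, with `h_r = 0` for `r < 0`. -/
noncomputable def complete (F : Type*) [Field F] : ℤ → SymFun F
  | Int.ofNat n => completeNat F n
  | Int.negSucc _ => 0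

/-- The Schur function `s_λ`, by the Jacobi-Trudi determinant `det (h_{λ_i + j - i})`. -/
noncomputable def schur (F : Type*) [Field F] (l : List ℕ) : SymFun F :=
  (Matrix.of fun i j : Fin l.length => complete F ((l.get i : ℤ) + (j : ℤ) - (i : ℤ))).det

/-- `z_λ = 1^{m_1} m_1! 2^{m_2} m_2! ⋯`, where `λ` has `m_r = a r` parts equal to `r`. -/
def zNat (a : ℕ+ →₀ ℕ) : ℕ := a.prod fun r m => (r : ℕ) ^ m * m.factorial

/-- The scalar product with `⟨p_λ, p_μ⟩ = δ_{λμ} z_λ`. -/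
noncomputable def hall (F : Type*) [Field F] : SymFun F →ₗ[F] SymFun F →ₗ[F] F :=
  (basisMonomials ℕ+ F).constr F fun a => (basisMonomials ℕ+ F).constr F fun b =>
    if a = b then (zNat a : F) else 0

open Classical in
/-- `perp f` is the adjoint `f^⊥` of the multiplication by `f`, see `hall_perp`. On products of
power sums, `p_μ^⊥ p_λ = (z_λ / z_ν) p_ν` if `λ = μ ∪ ν`, and `p_μ^⊥ p_λ = 0` if `μ` is not
contained in `λ`. -/
noncomputable def perp (F : Type*) [Field F] : SymFun F →ₗ[F] SymFun F →ₗ[F] SymFun F :=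
  (basisMonomials ℕ+ F).constr F fun a => (basisMonomials ℕ+ F).constr F fun b =>
    if a ≤ b then monomial (b - a) ((zNat b : F) / (zNat (b - a) : F)) else 0

/-- The plethysm `f ↦ f[X(t - 1)]`, that is `p_r ↦ (t^r - 1) p_r`. -/
noncomputable def plethysm {F : Type*} [Field F] (t : F) : SymFun F →ₐ[F] SymFun F :=
  aeval fun r : ℕ+ => C (t ^ (r : ℕ) - 1) * X r

theorem hall_monomial {F : Type*} [Field F] (a b : ℕ+ →₀ ℕ) (x y : F) :
    hall F (monomial a x) (monomial b y) = if a = b then x * y * (zNat a : F) else 0 := by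
  have hm : ∀ (c : ℕ+ →₀ ℕ) (u : F), monomial c u = u • basisMonomials ℕ+ F c := by
    intro c u; simp [smul_monomial]
  rw [hm, hm, hall, map_smul, map_smul, LinearMap.smul_apply, Module.Basis.constr_basis,
    Module.Basis.constr_basis]
  split_ifs <;> simp [mul_assoc, mul_left_comm]

theorem perp_monomial {F : Type*} [Field F] (a b : ℕ+ →₀ ℕ) (x y : F) :
    perp F (monomial a x) (monomial b y) =
      if a ≤ b then monomial (b - a) (x * y * ((zNat b : F) / (zNat (b - a) : F))) else 0 := by
  classical
  have hm : ∀ (c : ℕ+ →₀ ℕ) (u : F), monomial c u = u • basisMonomials ℕ+ F c := by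
    intro c u; simp [smul_monomial]
  rw [hm a, hm b, perp, map_smul, map_smul, LinearMap.smul_apply, Module.Basis.constr_basis,
    Module.Basis.constr_basis]
  split_ifs <;> simp [smul_monomial, mul_assoc, mul_left_comm]

theorem zNat_ne_zero (a : ℕ+ →₀ ℕ) : zNat a ≠ 0 := by
  rw [zNat, Finsupp.prod, Finset.prod_ne_zero_iff]
  intro r _
  exact mul_ne_zero (pow_ne_zero _ r.ne_zero) (Nat.factorial_ne_zero _)

/-- `⟨f^⊥ g, h⟩ = ⟨g, f h⟩`. -/
theorem hall_perp {F : Type*} [Field F] [CharZero F] (f g h : SymFun F) :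
    hall F (perp F f g) h = hall F g (f * h) := by
  induction f using MvPolynomial.induction_on' with
  | add p q hp hq => simp [add_mul, hp, hq]
  | monomial a x =>
    induction g using MvPolynomial.induction_on' with
    | add p q hp hq => simp [hp, hq]
    | monomial b y =>
      induction h using MvPolynomial.induction_on' with
      | add p q hp hq => simp [mul_add, hp, hq]
      | monomial c w =>
        rw [perp_monomial, monomial_mul, hall_monomial]
        by_cases hab : a ≤ b
        · rw [if_pos hab, hall_monomial]
          have hz : (zNat (b - a) : F) ≠ 0 := Nat.cast_ne_zero.mpr (zNat_ne_zero _)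
          by_cases hc : b - a = c
          · have hb : b = a + c := by rw [← hc, add_tsub_cancel_of_le hab]
            rw [if_pos hc, if_pos hb]
            field_simp
          · have hb : b ≠ a + c := by rintro rfl; simp at hc
            rw [if_neg hc, if_neg hb]
        · have hb : b ≠ a + c := by rintro rfl; exact hab le_self_add
          rw [if_neg hab, if_neg hb, map_zero, LinearMap.zero_apply]

/-! ## Vertex operators -/

theorem isWeightedHomogeneous_plethysm_completeNat {F : Type*} [Field F] (t : F) (n : ℕ) :
    IsWeightedHomogeneous (fun r : ℕ+ => (r : ℕ)) (plethysm t (completeNat F n)) n := by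
  induction n using Nat.strong_induction_on with
  | _ n ih =>
    rcases n with _ | n
    · simpa [completeNat] using isWeightedHomogeneous_one F (fun r : ℕ+ => (r : ℕ))
    · rw [completeNat, map_mul, map_sum]
      have hC : plethysm t (C ((n + 1 : F)⁻¹)) = C ((n + 1 : F)⁻¹) := by
        rw [plethysm, aeval_C]; rfl
      rw [hC]
      have hgoal : ∀ f : SymFun F, IsWeightedHomogeneous (fun r : ℕ+ => (r : ℕ)) f (n + 1) →
          IsWeightedHomogeneous (fun r : ℕ+ => (r : ℕ)) (C ((n + 1 : F)⁻¹) * f) (n + 1) := by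
        intro f hf
        simpa using (isWeightedHomogeneous_C (fun r : ℕ+ => (r : ℕ)) ((n + 1 : F)⁻¹)).mul hf
      refine hgoal _ (IsWeightedHomogeneous.sum _ _ _ fun i _ => ?_)
      have hX : plethysm t (X (i : ℕ).succPNat : SymFun F) =
          C (t ^ ((i : ℕ).succPNat : ℕ) - 1) * X (i : ℕ).succPNat := by
        rw [plethysm, aeval_X]
      rw [map_mul, hX]
      have h1 := ((isWeightedHomogeneous_C (fun r : ℕ+ => (r : ℕ))
        (t ^ ((i : ℕ).succPNat : ℕ) - 1)).mul
        (isWeightedHomogeneous_X F (fun r : ℕ+ => (r : ℕ)) (i : ℕ).succPNat)).mul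
        (ih (n - i) (by omega))
      have h2 : 0 + (((i : ℕ).succPNat : ℕ)) + (n - i) = n + 1 := by
        have := i.2
        rw [Nat.succPNat_coe]
        omega
      rw [h2] at h1
      exact h1

theorem perp_eq_zero_of_lt {F : Type*} [Field F] {f g : SymFun F} {n : ℕ}
    (hf : IsWeightedHomogeneous (fun r : ℕ+ => (r : ℕ)) f n)
    (hg : weightedTotalDegree (fun r : ℕ+ => (r : ℕ)) g < n) : perp F f g = 0 := by
  rw [f.as_sum, map_sum, LinearMap.sum_apply]
  refine Finset.sum_eq_zero fun a ha => ?_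
  conv_lhs => rw [g.as_sum]
  rw [map_sum]
  refine Finset.sum_eq_zero fun b hb => ?_
  rw [perp_monomial, if_neg]
  intro hab
  have h1 : Finsupp.weight (fun r : ℕ+ => (r : ℕ)) a = n := hf (mem_support_iff.mp ha)
  have h2 := le_weightedTotalDegree (fun r : ℕ+ => (r : ℕ)) hb
  have h3 : Finsupp.weight (fun r : ℕ+ => (r : ℕ)) a ≤ Finsupp.weight (fun r : ℕ+ => (r : ℕ)) b := by
    rw [← add_tsub_cancel_of_le hab, map_add]
    exact Nat.le_add_right _ _
  omega

/-- The sum that defines the vertex operators is finite on each symmetric function. -/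
theorem finite_support_vertexOp {F : Type*} [Field F] (t : F) (l : ℤ) (f : SymFun F) :
    (Function.support fun i : ℕ =>
      complete F (i + l) * perp F (plethysm t (completeNat F i)) f).Finite := by
  refine (Set.finite_Iic (weightedTotalDegree (fun r : ℕ+ => (r : ℕ)) f)).subset fun i hi => ?_
  by_contra h
  apply hi
  simp only [perp_eq_zero_of_lt (isWeightedHomogeneous_plethysm_completeNat t i)
    (not_le.mp h), mul_zero]

/-- The vertex operator `B_ℓ = ∑_{i ≥ 0} s_{i+ℓ}[X] s_i[X(t-1)]^⊥`, for `ℓ ∈ ℤ`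
(recall `s_r = h_r`). -/
noncomputable def vertexOp {F : Type*} [Field F] (t : F) (l : ℤ) : Module.End F (SymFun F) where
  toFun f := ∑ᶠ i : ℕ, complete F (i + l) * perp F (plethysm t (completeNat F i)) f
  map_add' f g := by
    rw [← finsum_add_distrib (finite_support_vertexOp t l f) (finite_support_vertexOp t l g)]
    simp only [map_add, mul_add]
  map_smul' c f := by
    rw [RingHom.id_apply, smul_finsum' c (finite_support_vertexOp t l f)]
    simp only [map_smul, mul_smul_comm]

/-- The product `B_{α_1} B_{α_2} ⋯ B_{α_m}` for a sequence `α` of integers. -/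
noncomputable def vertexWord {F : Type*} [Field F] (t : F) (α : List ℤ) :
    Module.End F (SymFun F) :=
  (α.map (vertexOp t)).prod

/-- The operator `B_λ = ∏_{i<j} (1 - t e_{ij}) B_{λ_1} ⋯ B_{λ_m}`, where `e_{ij}` raises the `i`-th
and lowers the `j`-th index of the formal product `B_{λ_1} ⋯ B_{λ_m}` by one. The product is
expanded: a set `A` of pairs `i < j` contributes `∏_{(i,j) ∈ A} (-t e_{ij})`. -/
noncomputable def vertexPart {F : Type*} [Field F] (t : F) (l : List ℕ) :
    Module.End F (SymFun F) :=
  ∑ A ∈ (Finset.univ.filter fun p : Fin l.length × Fin l.length => p.1 < p.2).powerset,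
    (-t) ^ A.card • vertexWord t (List.ofFn fun i : Fin l.length =>
      (l.get i : ℤ) + ((A.filter fun p => p.1 = i).card : ℤ)
        - ((A.filter fun p => p.2 = i).card : ℤ))

/-! ## Hall-Littlewood functions, `k`-split polynomials and `k`-Schur functions -/

/-- The Hall-Littlewood function `H_λ[X;t] = B_{λ_1} ⋯ B_{λ_ℓ} ⬝ 1`. -/
noncomputable def hallLittlewood {F : Type*} [Field F] (t : F) (l : List ℕ) : SymFun F :=
  vertexWord t (l.map fun a => (a : ℤ)) 1

/-- The space `Λ_t^{(k)}` spanned by the `H_λ[X;t]` with `λ` a `k`-bounded partition. -/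
noncomputable def boundedSpace {F : Type*} [Field F] (t : F) (k : ℕ) :
    Submodule F (SymFun F) :=
  Submodule.span F {f | ∃ l, IsBounded k l ∧ f = hallLittlewood t l}

/-- The generalized Schur function product: `ℋ_{()} = 1` and
`ℋ_{(λ^{(1)}, λ^{(2)}, …)} = B_{λ^{(1)}} ℋ_{(λ^{(2)}, …)}`. -/
noncomputable def genSchur {F : Type*} [Field F] (t : F) : List (List ℕ) → SymFun F
  | [] => 1
  | l :: S => vertexPart t l (genSchur t S)

/-- The `k`-split polynomial `G_λ^{(k)}[X;t] = ℋ_S[X;t]`, where `S` is the `k`-split of `λ`. -/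
noncomputable def splitPoly {F : Type*} [Field F] (t : F) (k : ℕ) (l : List ℕ) : SymFun F :=
  genSchur t (kSplit k l)

/-- The defining property of the projection `T̄_j^{(k)}`: it is the linear operator on `Λ_t^{(k)}`
that fixes `G_λ^{(k)}` if `λ_1 = j`, and kills it otherwise. -/
def IsProjection {F : Type*} [Field F] (t : F) (k j : ℕ)
    (T : boundedSpace t k →ₗ[F] boundedSpace t k) : Prop :=
  ∀ l, IsBounded k l → ∀ g : boundedSpace t k, (g : SymFun F) = splitPoly t k l →
    T g = if firstPart l = j then g else 0

open Classical in
/-- The projection `T̄_j^{(k)}` on `Λ_t^{(k)}`. (For generic `t` the `k`-split polynomials form a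
basis of `Λ_t^{(k)}`, so there is exactly one such operator.) -/
noncomputable def projection {F : Type*} [Field F] (t : F) (k j : ℕ) :
    boundedSpace t k →ₗ[F] boundedSpace t k :=
  if h : ∃ T, IsProjection t k j T then h.choose else 0

open Classical in
/-- The `k`-Schur function: `s_{()}^{(k)} = 1` and
`s_λ^{(k)} = T̄_{λ_1}^{(k)} B_{λ_1} s_{(λ_2, λ_3, …)}^{(k)}`. (The operators `B_i`, `i ≤ k`, preserve
`Λ_t^{(k)}`, so that the alternative below does not occur for `k`-bounded partitions.) -/
noncomputable def kSchur {F : Type*} [Field F] (t : F) (k : ℕ) : List ℕ → SymFun F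
  | [] => 1
  | a :: l =>
    if h : vertexOp t a (kSchur t k l) ∈ boundedSpace t k then
      (projection t k a ⟨vertexOp t a (kSchur t k l), h⟩ : SymFun F)
    else 0

end KSchur

/-! Both sides equal B_λ·1, where B_λ is `vertexPart`.

That B_λ·1 = s_λ holds for every λ. The relation B_a h_b - t B_{a+1} h_{b-1} = h_b B_a - h_{b-1}
B_{a+1} (`vertexOp_complete_mul`) says that pulling h_b out of B_a trades the factor 1 - t e for 1 -
e. Pulling everything out turns ∏(1 - t e_ij) B_{λ_1}⋯B_{λ_m}·1 into ∏(1 - e_ij) h_{λ_1}⋯h_{λ_m}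
(`evalForm_wordForm`), and this is the Jacobi-Trudi determinant by Vandermonde
(`evalForm_completeForm`).

That s^{(k)}_λ = B_λ·1 is proved by induction on the number of parts. For λ = (a, μ), the difference
B_λ - B_a B_μ is a combination of words B_b B_β with b > a, and the hook condition keeps all letters
at most k, because a letter is raised at most ℓ(λ) - 1 times. The commutation relation
`vertexOp_swap` straightens such words applied to 1 and only makes them lexicographically larger;
since G_ν is H_ν plus larger words, they lie in the span of the G_ν with ν_1 > a
(`vertexWord_one_mem_splitSpan`). The projection for a kills that span. It fixes B_λ·1, which is G_λ
because the k-split of λ has one piece.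

The projection, defined as 0 if no suitable operator exists, must be shown to exist, and this needs
the G_λ to be linearly independent. Setting h_n = 0 for n > a annihilates the image of B_b for b > a
and turns B_a into multiplication by h_a, so the largest parts can be peeled off one at a time
(`eq_zero_of_sum_truncate_prefixSplitPoly`). -/

namespace KSchur

open MvPolynomial

/-! ### Adjoints of multiplication, and power sums as derivations -/

section Perp

variable {F : Type*} [Field F]

theorem hall_monomial_right (f : SymFun F) (a : ℕ+ →₀ ℕ) :
    hall F f (monomial a 1) = coeff a f * (zNat a : F) := by
  induction f using MvPolynomial.induction_on' with
  | add p q hp hq => simp [hp, hq, add_mul]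
  | monomial b x =>
    rw [hall_monomial, coeff_monomial]
    split_ifs with h
    · rw [h, mul_one]
    · simp

theorem eq_of_hall_eq [CharZero F] {f g : SymFun F} (h : ∀ x, hall F f x = hall F g x) : f = g := by
  ext a
  have := h (monomial a 1)
  rw [hall_monomial_right, hall_monomial_right] at this
  exact mul_right_cancel₀ (Nat.cast_ne_zero.mpr (zNat_ne_zero a)) this

theorem perp_mul [CharZero F] (f g h : SymFun F) : perp F (f * g) h = perp F f (perp F g h) := by
  refine eq_of_hall_eq fun x => ?_
  rw [hall_perp, hall_perp, hall_perp, mul_comm f g, mul_assoc]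

theorem perp_comm [CharZero F] (f g h : SymFun F) :
    perp F f (perp F g h) = perp F g (perp F f h) := by
  rw [← perp_mul, mul_comm, perp_mul]

theorem perp_one [CharZero F] (f : SymFun F) : perp F 1 f = f := by
  refine eq_of_hall_eq fun x => ?_
  rw [hall_perp, one_mul]

theorem perp_C_mul (c : F) (f g : SymFun F) : perp F (C c * f) g = c • perp F f g := by
  rw [← smul_eq_C_mul, map_smul, LinearMap.smul_apply]

theorem zNat_add_single (b : ℕ+ →₀ ℕ) (r : ℕ+) :
    zNat (b + Finsupp.single r 1) = r * (b r + 1) * zNat b := by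
  classical
  have h : ∀ c : ℕ+ →₀ ℕ, zNat c =
      ((r : ℕ) ^ c r * (c r).factorial) * (c.erase r).prod fun r m => (r : ℕ) ^ m * m.factorial := by
    intro c
    rw [zNat, ← Finsupp.mul_prod_erase' c r _ fun _ => by simp]
  rw [h, h b, Finsupp.erase_add, Finsupp.erase_single, add_zero]
  simp only [Finsupp.add_apply, Finsupp.single_eq_same, pow_succ, Nat.factorial_succ]
  ring

theorem perp_X [CharZero F] (r : ℕ+) (f : SymFun F) :
    perp F (X r) f = ((r : ℕ) : F) • pderiv r f := by
  induction f using MvPolynomial.induction_on' with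
  | add p q hp hq => simp [hp, hq]
  | monomial b y =>
    rw [X, perp_monomial, pderiv_monomial, smul_monomial, one_mul]
    split_ifs with h
    · obtain ⟨c, rfl⟩ := exists_add_of_le h
      have hz : (zNat c : F) ≠ 0 := Nat.cast_ne_zero.mpr (zNat_ne_zero _)
      rw [add_tsub_cancel_left, add_comm, zNat_add_single]
      congr 1
      simp only [Finsupp.add_apply, Finsupp.single_eq_same, smul_eq_mul]
      push_cast
      field_simp
    · have : b r = 0 := by
        rw [Finsupp.single_le_iff] at h
        omega
      simp [this]

theorem perp_X_mul [CharZero F] (r : ℕ+) (f g : SymFun F) :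
    perp F (X r) (f * g) = perp F (X r) f * g + f * perp F (X r) g := by
  rw [perp_X, perp_X, perp_X, Derivation.leibniz]
  simp only [smul_eq_C_mul, smul_eq_mul]
  ring

theorem perp_X_C_mul (r : ℕ+) (c : F) (f : SymFun F) :
    perp F (X r) (C c * f) = C c * perp F (X r) f := by
  rw [← smul_eq_C_mul, ← smul_eq_C_mul, map_smul]

theorem perp_X_X [CharZero F] (r s : ℕ+) :
    perp F (X r) (X s : SymFun F) = if s = r then C ((r : ℕ) : F) else 0 := by
  rw [perp_X, pderiv_X]
  split_ifs with h
  · subst h; simp [smul_eq_C_mul]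
  · simp [h]

theorem perp_X_one [CharZero F] (r : ℕ+) : perp F (X r) (1 : SymFun F) = 0 := by
  rw [perp_X, Derivation.map_one_eq_zero, smul_zero]

/-- The commutator of `f^⊥` with the multiplication by `p_r` is `(p_r^⊥ f)^⊥`. -/
theorem perp_mul_X [CharZero F] (f g : SymFun F) (r : ℕ+) :
    perp F f (X r * g) = X r * perp F f g + perp F (perp F (X r) f) g := by
  induction f using MvPolynomial.induction_on generalizing g with
  | C c =>
    have h : ∀ x : SymFun F, perp F (C c) x = c • x := by
      intro x
      rw [← mul_one (C c), perp_C_mul, perp_one]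
    rw [h, h, ← mul_one (C c), perp_X_C_mul, perp_X_one]
    simp
  | add p q hp hq => simp only [map_add, LinearMap.add_apply, hp, hq]; ring
  | mul_X p s hp =>
    rw [perp_mul, perp_X_mul, perp_X_X, map_add, hp, perp_mul, perp_X_mul r p, perp_X_X, map_add,
      LinearMap.add_apply, perp_mul (perp F (X r) p)]
    by_cases h : r = s
    · subst h
      rw [if_pos rfl, mul_comm p, perp_C_mul, ← smul_eq_C_mul, map_smul]
      ring
    · rw [if_neg h, if_neg (Ne.symm h)]
      simp

end Perp

/-! ### Newton's identity and p_r^⊥ on complete functions -/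

section Complete

variable {F : Type*} [Field F]

theorem complete_natCast (n : ℕ) : complete F (n : ℤ) = completeNat F n := rfl

theorem complete_of_neg {n : ℤ} (h : n < 0) : complete F n = 0 := by
  obtain ⟨m, rfl⟩ := Int.exists_eq_neg_ofNat h.le
  rcases m with _ | m
  · simp at h
  · rfl

theorem complete_zero : complete F 0 = 1 := by
  rw [← Nat.cast_zero, complete_natCast, completeNat]

theorem succ_mul_completeNat [CharZero F] (n : ℕ) :
    C (n + 1 : F) * completeNat F (n + 1) =
      ∑ i ∈ Finset.range (n + 1), X i.succPNat * completeNat F (n - i) := by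
  have h : (n + 1 : F) ≠ 0 := by exact_mod_cast n.succ_ne_zero
  rw [completeNat, ← mul_assoc, ← C_mul, mul_inv_cancel₀ h, C_1, one_mul,
    Fin.sum_univ_eq_sum_range (fun i => X i.succPNat * completeNat F (n - i)) (n + 1)]

/-- Newton's identity. -/
theorem mul_complete [CharZero F] {n : ℤ} {N : ℕ} (h : n ≤ N) :
    C (n : F) * complete F n =
      ∑ i ∈ Finset.range N, X i.succPNat * complete F (n - (i + 1)) := by
  rcases lt_or_ge 0 n with hn | hn
  · obtain ⟨m, rfl⟩ : ∃ m : ℕ, n = ((m + 1 : ℕ) : ℤ) := ⟨n.toNat - 1, by omega⟩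
    have hN : m + 1 ≤ N := by exact_mod_cast h
    rw [complete_natCast, Int.cast_natCast, Nat.cast_succ, succ_mul_completeNat]
    rw [← Finset.sum_subset (Finset.range_mono hN)]
    · refine Finset.sum_congr rfl fun i hi => ?_
      rw [Finset.mem_range] at hi
      rw [← complete_natCast]
      congr 2
      push_cast [Nat.le_of_lt_succ hi]
      ring
    · intro i _ hi
      rw [Finset.mem_range] at hi
      rw [complete_of_neg (by push_cast; omega), mul_zero]
  · rw [Finset.sum_eq_zero]
    · rcases hn.lt_or_eq with hn | rfl
      · rw [complete_of_neg hn, mul_zero]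
      · simp
    · intro i _
      rw [complete_of_neg (by omega), mul_zero]

/-- Applying the derivation p_r^⊥ to Newton's identity for h_n gives, by induction, Newton's
identity for h_{n-r} plus the extra term r h_{n-r}; the factors (n - r) + r add up to n. -/
theorem perp_X_complete [CharZero F] (r : ℕ+) (n : ℤ) :
    perp F (X r) (complete F n) = complete F (n - (r : ℕ)) := by
  have hr := r.pos
  rcases lt_or_ge n 0 with hn | hn
  · rw [complete_of_neg hn, complete_of_neg (by omega), map_zero]
  obtain ⟨n, rfl⟩ := Int.eq_ofNat_of_zero_le hn
  induction n using Nat.strong_induction_on with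
  | _ n ih =>
    rcases n with _ | n
    · rw [Nat.cast_zero, complete_zero, perp_X_one, complete_of_neg (by omega)]
    have hne : C ((((n + 1 : ℕ) : ℤ) : F)) ≠ (0 : SymFun F) := by
      rw [Ne, C_eq_zero]
      exact_mod_cast n.succ_ne_zero
    refine mul_left_cancel₀ hne ?_
    -- The range is long enough for Newton's identity at both n + 1 and n + 1 - r, and contains the
    -- index r - 1 of p_r even when r > n + 1.
    have key : ∀ i ∈ Finset.range (n + 1 + r),
        perp F (X r) (X i.succPNat * complete F (((n + 1 : ℕ) : ℤ) - (i + 1))) =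
        (if i.succPNat = r then C ((r : ℕ) : F) * complete F (((n + 1 : ℕ) : ℤ) - (r : ℕ)) else 0) +
        X i.succPNat * complete F (((n + 1 : ℕ) : ℤ) - (r : ℕ) - (i + 1)) := by
      intro i _
      rw [perp_X_mul, perp_X_X]
      congr 1
      · split_ifs with h
        · rw [← h, Nat.succPNat_coe]; norm_num
        · rw [zero_mul]
      · congr 1
        rcases le_or_gt i n with hi | hi
        · have := ih (n - i) (by omega) (by omega)
          rw [show ((n + 1 : ℕ) : ℤ) - (i + 1) = ((n - i : ℕ) : ℤ) by omega, this]
          congr 1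
          omega
        · rw [complete_of_neg (by omega), complete_of_neg (by omega), map_zero]
    rw [← perp_X_C_mul, mul_complete (N := n + 1 + r) (by push_cast; omega), map_sum,
      Finset.sum_congr rfl key, Finset.sum_add_distrib, ← mul_complete (by push_cast; omega)]
    rw [Finset.sum_eq_single (r.natPred)]
    · rw [if_pos (PNat.succPNat_natPred r), ← add_mul, ← C_add]
      push_cast
      congr 2
      ring
    · intro i _ hi
      rw [if_neg]
      rintro rfl
      simp at hi
    · intro h
      exfalso
      apply h
      rw [Finset.mem_range]
      have := r.natPred_add_one
      omega

end Complete

/-! ### The operators h_i[X(t-1)]^⊥ -/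

section Skew

variable {F : Type*} [Field F] (t : F)

/-- The operator `h_i[X(t-1)]^⊥`. -/
noncomputable def skewOp (i : ℤ) : Module.End F (SymFun F) := perp F (plethysm t (complete F i))

theorem skewOp_of_neg {i : ℤ} (h : i < 0) : skewOp t i = 0 := by
  rw [skewOp, complete_of_neg h, map_zero, map_zero]

theorem skewOp_zero [CharZero F] (f : SymFun F) : skewOp t 0 f = f := by
  rw [skewOp, complete_zero, map_one, perp_one]

theorem skewOp_comm [CharZero F] (i j : ℤ) (f : SymFun F) :
    skewOp t i (skewOp t j f) = skewOp t j (skewOp t i f) := perp_comm _ _ _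

theorem plethysm_C (c : F) : plethysm t (C c) = C c := by
  rw [plethysm, aeval_C]; rfl

theorem plethysm_X (r : ℕ+) : plethysm t (X r) = C (t ^ (r : ℕ) - 1) * X r := by
  rw [plethysm, aeval_X]

theorem perp_X_plethysm [CharZero F] (r : ℕ+) (f : SymFun F) :
    perp F (X r) (plethysm t f) = C (t ^ (r : ℕ) - 1) * plethysm t (perp F (X r) f) := by
  induction f using MvPolynomial.induction_on with
  | C c =>
    rw [plethysm_C, ← mul_one (C c), perp_X_C_mul, perp_X_one]
    simp
  | add p q hp hq => simp only [map_add, hp, hq, mul_add]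
  | mul_X p s hp =>
    rw [map_mul, perp_X_mul, hp, plethysm_X, perp_X_C_mul, perp_X_mul, map_add, map_mul, map_mul,
      plethysm_X, perp_X_X]
    split_ifs with h
    · subst h
      rw [plethysm_C]; ring
    · rw [map_zero]; ring

theorem skewOp_X_mul [CharZero F] (i : ℤ) (r : ℕ+) (f : SymFun F) :
    skewOp t i (X r * f) =
      X r * skewOp t i f + (t ^ (r : ℕ) - 1) • skewOp t (i - (r : ℕ)) f := by
  rw [skewOp, perp_mul_X, perp_X_plethysm, perp_X_complete, perp_C_mul]
  rfl

/-- The values `h_n[t-1]`. -/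
def completeSub : ℕ → F
  | 0 => 1
  | n + 1 => t ^ (n + 1) - t ^ n

/-- Newton's identity at the alphabet t - 1, where p_r is t^r - 1. Partial sums have a closed form
as long as they avoid the last term, in which `completeSub` takes its exceptional value 1. -/
theorem succ_mul_completeSub (m : ℕ) :
    ((m + 1 : F)) * completeSub t (m + 1) =
      ∑ r ∈ Finset.range (m + 1), (t ^ (r + 1) - 1) * completeSub t (m - r) := by
  have key : ∀ s ≤ m, ∑ r ∈ Finset.range s, (t ^ (r + 1) - 1) * completeSub t (m - r) =
      s * (t ^ (m + 1) - t ^ m) - t ^ m + t ^ (m - s) := by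
    intro s hs
    induction s with
    | zero => simp
    | succ s ih =>
      obtain ⟨d, rfl⟩ : ∃ d, m = s + 1 + d := ⟨m - (s + 1), by omega⟩
      rw [Finset.sum_range_succ, ih (by omega), show s + 1 + d - s = d + 1 by omega,
        show s + 1 + d - (s + 1) = d by omega, completeSub]
      push_cast
      ring
  rw [Finset.sum_range_succ, key m le_rfl, Nat.sub_self, completeSub, completeSub]
  ring

/-- In generating functions, the adjoint shifts X to X + (t-1)u, which multiplies ∑ h_n z^n by ∑
h_i[t-1] (uz)^i. The proof compares Newton's identities for h_i[X(t-1)] and h_i[t-1]. -/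
theorem skewOp_complete [CharZero F] (i : ℕ) (n : ℤ) :
    skewOp t i (complete F n) = completeSub t i • complete F (n - i) := by
  induction i using Nat.strong_induction_on generalizing n with
  | _ i ih =>
    rcases i with _ | i
    · rw [Nat.cast_zero, skewOp_zero, completeSub, one_smul, sub_zero]
    have hne : (i + 1 : F) ≠ 0 := by exact_mod_cast i.succ_ne_zero
    refine smul_right_injective _ hne ?_
    simp only
    rw [skewOp, complete_natCast, ← perp_C_mul, ← plethysm_C t, ← map_mul, succ_mul_completeNat,
      map_sum, map_sum, LinearMap.sum_apply, smul_smul, succ_mul_completeSub, Finset.sum_smul]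
    refine Finset.sum_congr rfl fun r hr => ?_
    rw [Finset.mem_range] at hr
    rw [map_mul, plethysm_X, mul_assoc, perp_C_mul, perp_mul]
    have := ih (i - r) (by omega) n
    rw [skewOp, complete_natCast] at this
    rw [this, map_smul, perp_X_complete, smul_smul, Nat.succPNat_coe]
    congr 2
    push_cast [Nat.le_of_lt_succ hr]
    ring

theorem skewOp_one [CharZero F] {i : ℤ} (h : i ≠ 0) : skewOp t i 1 = 0 := by
  rcases lt_or_ge i 0 with hi | hi
  · rw [skewOp_of_neg t hi, LinearMap.zero_apply]
  · obtain ⟨i, rfl⟩ := Int.eq_ofNat_of_zero_le hi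
    rw [← complete_zero, skewOp_complete, complete_of_neg (by omega), smul_zero]

/-- The shift X ↦ X + (t-1)u multiplies ∑ h_n z^n by (1 - uz)/(1 - tuz). This is the resulting
commutation rule, cleared of its denominator. -/
theorem skewOp_complete_mul [CharZero F] (i n : ℤ) (f : SymFun F) :
    skewOp t i (complete F n * f) - t • skewOp t (i - 1) (complete F (n - 1) * f) =
      complete F n * skewOp t i f - complete F (n - 1) * skewOp t (i - 1) f := by
  induction f using MvPolynomial.induction_on generalizing i with
  | C c =>
    rw [← mul_one (C c), ← smul_eq_C_mul]
    simp only [mul_smul_comm, map_smul, mul_one]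
    rw [smul_comm t c, ← smul_sub, ← smul_sub]
    congr 1
    rcases lt_or_ge i 0 with hi | hi
    · rw [skewOp_of_neg t hi, skewOp_of_neg t (show i - 1 < 0 by omega)]
      simp
    obtain ⟨i, rfl⟩ := Int.eq_ofNat_of_zero_le hi
    -- The coefficients of 1 - uz: h_i[t-1] - t h_{i-1}[t-1] is 1, -1 and 0 for i = 0, i = 1 and i ≥
    -- 2.
    rcases i with _ | _ | i
    · rw [Nat.cast_zero, skewOp_zero, skewOp_zero, skewOp_of_neg t (show (0 - 1 : ℤ) < 0 by omega)]
      simp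
    · rw [skewOp_complete, zero_add, Nat.cast_one, sub_self, skewOp_zero, skewOp_one t one_ne_zero,
        skewOp_zero, completeSub, sub_eq_sub_iff_sub_eq_sub]
      simp [sub_smul]
    · rw [skewOp_complete, show ((i + 1 + 1 : ℕ) : ℤ) - 1 = (i + 1 : ℕ) by push_cast; ring,
        skewOp_complete, skewOp_one t (by omega), skewOp_one t (by omega),
        show n - 1 - (i + 1 : ℕ) = n - (i + 1 + 1 : ℕ) by push_cast; ring, completeSub, completeSub,
        smul_smul, ← sub_smul]
      rw [show t ^ (i + 1 + 1) - t ^ (i + 1) - t * (t ^ (i + 1) - t ^ i) = 0 by ring]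
      simp
  | add p q hp hq =>
    have := congrArg₂ (· + ·) (hp i) (hq i)
    simp only [mul_add, map_add, smul_add] at this ⊢
    linear_combination this
  -- Moving p_r out of each adjoint costs a multiple of the same identity at i - r.
  | mul_X p r hp =>
    have h1 := hp i
    have h2 := hp (i - (r : ℕ))
    rw [mul_comm p, mul_left_comm _ (X r), mul_left_comm _ (X r), skewOp_X_mul, skewOp_X_mul, skewOp_X_mul,
      skewOp_X_mul]
    simp only [smul_eq_C_mul] at h1 h2 ⊢
    rw [sub_right_comm i _ 1] at h2
    linear_combination X r * h1 + C (t ^ (r : ℕ) - 1) * h2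

/-- The operators `h_i[X(t-1)]^⊥` with large `i` vanish on a given symmetric function. -/
theorem exists_skewOp_eq_zero (f : SymFun F) : ∃ N : ℕ, ∀ i : ℤ, N ≤ i → skewOp t i f = 0 := by
  refine ⟨weightedTotalDegree (fun r : ℕ+ => (r : ℕ)) f + 1, fun i hi => ?_⟩
  obtain ⟨i, rfl⟩ := Int.eq_ofNat_of_zero_le (show 0 ≤ i by omega)
  exact perp_eq_zero_of_lt (isWeightedHomogeneous_plethysm_completeNat t i) (by omega)

end Skew

/-! ### Commutation relations of the vertex operators -/

section Vertex

variable {F : Type*} [Field F] (t : F)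

theorem vertexOp_apply (l : ℤ) (f : SymFun F) {N : ℕ} (hN : ∀ i : ℤ, N ≤ i → skewOp t i f = 0) :
    vertexOp t l f = ∑ i ∈ Finset.range N, complete F (i + l) * skewOp t i f := by
  change ∑ᶠ i : ℕ, complete F (i + l) * skewOp t i f = _
  refine finsum_eq_finsetSum_of_support_subset _ fun i hi => ?_
  rw [Finset.coe_range, Set.mem_Iio]
  by_contra h
  apply hi
  simp only [hN i (by omega), mul_zero]

theorem vertexOp_one [CharZero F] (l : ℤ) : vertexOp t l 1 = complete F l := by
  rw [vertexOp_apply t l 1 (N := 1) fun i hi => skewOp_one t (by omega)]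
  simp [skewOp_zero]

/-- The sum over i of h_{i+a} times `skewOp_complete_mul`. -/
theorem vertexOp_complete_mul [CharZero F] (a b : ℤ) (f : SymFun F) :
    vertexOp t a (complete F b * f) - t • vertexOp t (a + 1) (complete F (b - 1) * f) =
      complete F b * vertexOp t a f - complete F (b - 1) * vertexOp t (a + 1) f := by
  obtain ⟨N₁, h₁⟩ := exists_skewOp_eq_zero t f
  obtain ⟨N₂, h₂⟩ := exists_skewOp_eq_zero t (complete F b * f)
  obtain ⟨N₃, h₃⟩ := exists_skewOp_eq_zero t (complete F (b - 1) * f)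
  set N := max N₁ (max N₂ N₃)
  have e₁ : (N₁ : ℤ) ≤ N := by exact_mod_cast le_max_left _ _
  have e₂ : (N₂ : ℤ) ≤ N := by exact_mod_cast (le_max_left _ _).trans (le_max_right _ _)
  have e₃ : (N₃ : ℤ) ≤ N := by exact_mod_cast (le_max_right _ _).trans (le_max_right _ _)
  -- The sums for B_a get one more term than those for B_{a+1}: after splitting off i = 0, index i +
  -- 1 for B_a matches index i for B_{a+1}.
  rw [vertexOp_apply t a (N := N + 1) _ fun i hi => h₂ i (by push_cast at hi; omega),
    vertexOp_apply t a (N := N + 1) _ fun i hi => h₁ i (by push_cast at hi; omega),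
    vertexOp_apply t (a + 1) (N := N) _ fun i hi => h₃ i (by omega),
    vertexOp_apply t (a + 1) (N := N) _ fun i hi => h₁ i (by omega),
    Finset.sum_range_succ', Finset.sum_range_succ']
  simp only [Nat.cast_zero, skewOp_zero, mul_add, Finset.mul_sum, Finset.smul_sum]
  rw [add_sub_right_comm, add_sub_right_comm, ← Finset.sum_sub_distrib, ← Finset.sum_sub_distrib]
  congr 1
  · refine Finset.sum_congr rfl fun i _ => ?_
    have h := skewOp_complete_mul t (i + 1) b f
    rw [add_sub_cancel_right] at h
    rw [show ((i + 1 : ℕ) : ℤ) + a = i + (a + 1) by push_cast; ring]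
    push_cast
    simp only [smul_eq_C_mul] at h ⊢
    linear_combination complete F (i + (a + 1)) * h
  · ring

/-- The sum `∑_{i,j} h_{m+i} h_{n+j} h_i[X(t-1)]^⊥ h_j[X(t-1)]^⊥`, over `i, j < N`. -/
noncomputable def doubleSum (N : ℕ) (m n : ℤ) (f : SymFun F) : SymFun F :=
  ∑ j ∈ Finset.range N, ∑ i ∈ Finset.range N,
    complete F (j + n) * (complete F (i + m) * skewOp t i (skewOp t j f))

theorem doubleSum_comm [CharZero F] (N : ℕ) (m n : ℤ) (f : SymFun F) :
    doubleSum t N m n f = doubleSum t N n m f := by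
  rw [doubleSum, Finset.sum_comm, doubleSum]
  refine Finset.sum_congr rfl fun i _ => Finset.sum_congr rfl fun j _ => ?_
  rw [skewOp_comm]
  ring

/-- Expanding the inner operators as ∑ h_{j+n} h_j[X(t-1)]^⊥ and pulling out h_{j+n} for each j
leaves double sums with all multiplications on the left, which are symmetric in their two indices.
-/
theorem vertexOp_vertexOp [CharZero F] (m n : ℤ) (f : SymFun F) {N : ℕ}
    (hN : ∀ i : ℤ, N ≤ i → skewOp t i f = 0) :
    vertexOp t m (vertexOp t n f) - t • vertexOp t (m + 1) (vertexOp t (n - 1) f) =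
      doubleSum t N m n f - doubleSum t N (m + 1) (n - 1) f := by
  have h : ∀ a b, doubleSum t N a b f =
      ∑ j ∈ Finset.range N, complete F (j + b) * vertexOp t a (skewOp t j f) := by
    intro a b
    refine Finset.sum_congr rfl fun j _ => ?_
    rw [vertexOp_apply t a (N := N) _ fun i hi => by rw [skewOp_comm, hN i hi, map_zero],
      Finset.mul_sum]
  rw [h, h, vertexOp_apply t n f hN, vertexOp_apply t (n - 1) f hN, map_sum, map_sum,
    Finset.smul_sum, ← Finset.sum_sub_distrib, ← Finset.sum_sub_distrib]
  refine Finset.sum_congr rfl fun j _ => ?_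
  have := vertexOp_complete_mul t m (j + n) (skewOp t j f)
  rwa [add_sub_assoc] at this

/-- The right-hand side of `vertexOp_vertexOp` changes sign under (m, n) ↦ (n - 1, m + 1), by
symmetry of the double sums. -/
theorem vertexOp_swap [CharZero F] (m n : ℤ) (f : SymFun F) :
    vertexOp t m (vertexOp t n f) = t • vertexOp t n (vertexOp t m f) +
      t • vertexOp t (m + 1) (vertexOp t (n - 1) f) - vertexOp t (n - 1) (vertexOp t (m + 1) f) := by
  obtain ⟨N, hN⟩ := exists_skewOp_eq_zero t f
  have h1 := vertexOp_vertexOp t m n f hN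
  have h2 := vertexOp_vertexOp t (n - 1) (m + 1) f hN
  rw [sub_add_cancel, add_sub_cancel_right, doubleSum_comm t N n, doubleSum_comm t N (n - 1)] at h2
  linear_combination h1 + h2

/-- For n = m + 1 the two double sums cancel. In this case `vertexOp_swap` would bring back the word
that is to be straightened. -/
theorem vertexOp_swap_succ [CharZero F] (m : ℤ) (f : SymFun F) :
    vertexOp t m (vertexOp t (m + 1) f) = t • vertexOp t (m + 1) (vertexOp t m f) := by
  obtain ⟨N, hN⟩ := exists_skewOp_eq_zero t f
  have h1 := vertexOp_vertexOp t m (m + 1) f hN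
  rw [add_sub_cancel_right, doubleSum_comm t N m, sub_self] at h1
  exact sub_eq_zero.mp h1

end Vertex

/-! ### Raising operators as Laurent polynomials, and Jacobi-Trudi -/

section GroupRing

open AddMonoidAlgebra (single)

variable {F : Type*} [Field F] {ι M : Type*} [AddCommGroup M] [Module F M]

/-- The linear extension to formal sums of words of a function on words. -/
noncomputable def evalForm (Φ : (ι → ℤ) → M) : AddMonoidAlgebra F (ι → ℤ) →ₗ[F] M :=
  Finsupp.linearCombination F Φ ∘ₗ (AddMonoidAlgebra.coeffLinearEquiv F).toLinearMap

theorem evalForm_single (Φ : (ι → ℤ) → M) (w : ι → ℤ) (c : F) :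
    evalForm Φ (single w c) = c • Φ w := by
  simp [evalForm, AddMonoidAlgebra.coeffLinearEquiv]

/-- Lets an identity between raising operators be checked on single words and then used in the
presence of further factors g. -/
theorem evalForm_mul_congr {Φ Ψ : (ι → ℤ) → M} {x y : AddMonoidAlgebra F (ι → ℤ)}
    (h : ∀ w, evalForm Φ (x * single w 1) = evalForm Ψ (y * single w 1))
    (g : AddMonoidAlgebra F (ι → ℤ)) : evalForm Φ (x * g) = evalForm Ψ (y * g) := by
  induction g using AddMonoidAlgebra.induction_linear with
  | zero => simp
  | add f g hf hg => simp only [mul_add, map_add, hf, hg]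
  | single w c =>
    have hc : (single w c : AddMonoidAlgebra F (ι → ℤ)) = c • single w 1 := by
      rw [AddMonoidAlgebra.smul_single, smul_eq_mul, mul_one]
    rw [hc, mul_smul_comm, mul_smul_comm, map_smul, map_smul, h]

theorem prod_single {α : Type*} (S : Finset α) (w : α → ι → ℤ) (c : α → F) :
    ∏ i ∈ S, single (w i) (c i) = (single (∑ i ∈ S, w i) (∏ i ∈ S, c i) :
      AddMonoidAlgebra F (ι → ℤ)) := by
  classical
  induction S using Finset.induction_on with
  | empty => simp [AddMonoidAlgebra.one_def]
  | insert a S ha ih =>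
    rw [Finset.prod_insert ha, ih, AddMonoidAlgebra.single_mul_single, Finset.prod_insert ha,
      Finset.sum_insert ha]

variable [DecidableEq ι]

/-- The formal operator `1 - q e_{ij}`. -/
noncomputable def raising (q : F) (i j : ι) : AddMonoidAlgebra F (ι → ℤ) :=
  1 - single (Pi.single i 1 - Pi.single j 1) q

theorem evalForm_raising_mul (Φ : (ι → ℤ) → M) (q : F) (i j : ι) (w : ι → ℤ) :
    evalForm Φ (raising q i j * single w 1) =
      Φ w - q • Φ (Pi.single i 1 - Pi.single j 1 + w) := by
  rw [raising, sub_mul, one_mul, AddMonoidAlgebra.single_mul_single, map_sub, evalForm_single,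
    evalForm_single, one_smul, mul_one]

/-- The formal operator `∏_{i<j} (1 - q e_{ij})`. -/
noncomputable def raisingProd (q : F) (n : ℕ) : AddMonoidAlgebra F (Fin n → ℤ) :=
  ∏ i, ∏ j ∈ Finset.Ioi i, raising q i j

/-- Prefixing a word by the letter `0`. -/
noncomputable def consHom (F : Type*) [Field F] (n : ℕ) :
    AddMonoidAlgebra F (Fin n → ℤ) →+* AddMonoidAlgebra F (Fin (n + 1) → ℤ) :=
  AddMonoidAlgebra.mapDomainRingHom F
    { toFun := fun w => (Fin.cons 0 w : Fin (n + 1) → ℤ)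
      map_zero' := by ext i; refine Fin.cases ?_ (fun i => ?_) i <;> simp
      map_add' := fun v w => by ext i; refine Fin.cases ?_ (fun i => ?_) i <;> simp }

theorem consHom_single {n : ℕ} (w : Fin n → ℤ) (c : F) :
    consHom F n (single w c) = single (Fin.cons 0 w : Fin (n + 1) → ℤ) c := by
  simp [consHom]

theorem consHom_raising {n : ℕ} (q : F) (i j : Fin n) :
    consHom F n (raising q i j) = raising q i.succ j.succ := by
  rw [raising, map_sub, map_one, consHom_single, raising]
  congr 2
  ext l
  refine Fin.cases ?_ (fun l => ?_) l
  · simp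
  · simp [Pi.single_apply]

theorem raisingProd_succ (q : F) (n : ℕ) :
    raisingProd q (n + 1) = (∏ j : Fin n, raising q 0 j.succ) * consHom F n (raisingProd q n) := by
  rw [raisingProd, Fin.prod_univ_succ, Fin.prod_Ioi_zero, raisingProd, map_prod]
  congr 1
  refine Finset.prod_congr rfl fun i _ => ?_
  rw [Fin.prod_Ioi_succ, map_prod]
  exact Finset.prod_congr rfl fun j _ => (consHom_raising q i j).symm

/-- Raising operators that leave the first letter alone can be evaluated inside the linear map
attached to that letter, such as B_a. -/
theorem evalForm_consHom_mul {n : ℕ} {N : Type*} [AddCommGroup N] [Module F N]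
    (Φ : (Fin (n + 1) → ℤ) → M) (Ψ : (Fin n → ℤ) → N) (a : ℤ) (L : N →ₗ[F] M)
    (h : ∀ w, Φ (Fin.cons a w) = L (Ψ w)) (x : AddMonoidAlgebra F (Fin n → ℤ)) (w : Fin n → ℤ) :
    evalForm Φ (consHom F n x * single (Fin.cons a w) 1) = L (evalForm Ψ (x * single w 1)) := by
  induction x using AddMonoidAlgebra.induction_linear with
  | zero => simp
  | add f g hf hg => simp only [add_mul, map_add, hf, hg]
  | single v c =>
    have hv : (Fin.cons 0 v + Fin.cons a w : Fin (n + 1) → ℤ) = Fin.cons a (v + w) := by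
      ext i; refine Fin.cases ?_ (fun i => ?_) i <;> simp
    rw [consHom_single, AddMonoidAlgebra.single_mul_single, hv,
      AddMonoidAlgebra.single_mul_single, evalForm_single, evalForm_single, h, map_smul]

/-- The function `α ↦ B_{α_1} ⋯ B_{α_n} ⬝ f` on words. -/
noncomputable def wordForm (t : F) {n : ℕ} (f : SymFun F) (w : Fin n → ℤ) : SymFun F :=
  vertexWord t (List.ofFn w) f

/-- The function `α ↦ h_{α_1} ⋯ h_{α_n}` on words. -/
noncomputable def completeForm (F : Type*) [Field F] {n : ℕ} (w : Fin n → ℤ) : SymFun F :=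
  ∏ i, complete F (w i)

/-- The function on words which multiplies the `h`-letters outside of `S`, then applies the vertex
operator of the first letter, then multiplies by the `h`-letters in `S`. -/
noncomputable def mixedForm (t : F) {n : ℕ} (S : Finset (Fin n)) (w : Fin (n + 1) → ℤ) :
    SymFun F :=
  (∏ j ∈ S, complete F (w j.succ)) * vertexOp t (w 0) (∏ j ∈ Sᶜ, complete F (w j.succ))

/-- This is `vertexOp_complete_mul` for the first letter and letter j: pulling h_{w_j} out of the
vertex operator changes 1 - t e into 1 - e. -/
theorem evalForm_mixedForm_insert [CharZero F] (t : F) {n : ℕ} {S : Finset (Fin n)} {j : Fin n}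
    (hj : j ∉ S) (g : AddMonoidAlgebra F (Fin (n + 1) → ℤ)) :
    evalForm (mixedForm t S) (raising t 0 j.succ * g) =
      evalForm (mixedForm t (insert j S)) (raising 1 0 j.succ * g) := by
  refine evalForm_mul_congr (fun w => ?_) g
  rw [evalForm_raising_mul, evalForm_raising_mul, one_smul]
  have hS : Sᶜ = insert j (insert j S)ᶜ := by
    ext i
    simp only [Finset.mem_compl, Finset.mem_insert, not_or]
    by_cases h : i = j
    · simp [h, hj]
    · simp [h]
  have hj' : j ∉ (insert j S)ᶜ := by simp
  have hne : ∀ i : Fin n, i ≠ j →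
      (Pi.single 0 1 - Pi.single j.succ 1 + w : Fin (n + 1) → ℤ) i.succ = w i.succ := by
    intro i hi
    simp [hi]
  have h1 : ∏ i ∈ S, complete F ((Pi.single 0 1 - Pi.single j.succ 1 + w : Fin (n + 1) → ℤ) i.succ)
      = ∏ i ∈ S, complete F (w i.succ) :=
    Finset.prod_congr rfl fun i hi => by rw [hne i (ne_of_mem_of_not_mem hi hj)]
  have h2 : ∏ i ∈ (insert j S)ᶜ,
      complete F ((Pi.single 0 1 - Pi.single j.succ 1 + w : Fin (n + 1) → ℤ) i.succ)
      = ∏ i ∈ (insert j S)ᶜ, complete F (w i.succ) :=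
    Finset.prod_congr rfl fun i hi => by rw [hne i (ne_of_mem_of_not_mem hi hj')]
  have h3 : (Pi.single 0 1 - Pi.single j.succ 1 + w : Fin (n + 1) → ℤ) j.succ = w j.succ - 1 := by
    simp; ring
  have h4 : (Pi.single 0 1 - Pi.single j.succ 1 + w : Fin (n + 1) → ℤ) 0 = w 0 + 1 := by
    simp [(Fin.succ_ne_zero j).symm]; ring
  have key := vertexOp_complete_mul t (w 0) (w j.succ) (∏ i ∈ (insert j S)ᶜ, complete F (w i.succ))
  simp only [mixedForm, hS, Finset.prod_insert hj', Finset.prod_insert hj, h1, h2, h3, h4]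
  simp only [smul_eq_C_mul] at key ⊢
  linear_combination (∏ i ∈ S, complete F (w i.succ)) * key

theorem evalForm_mixedForm_empty [CharZero F] (t : F) {n : ℕ} (S : Finset (Fin n))
    (g : AddMonoidAlgebra F (Fin (n + 1) → ℤ)) :
    evalForm (mixedForm t ∅) ((∏ j ∈ S, raising t 0 j.succ) * g) =
      evalForm (mixedForm t S) ((∏ j ∈ S, raising 1 0 j.succ) * g) := by
  induction S using Finset.induction_on generalizing g with
  | empty => simp
  | insert j S hj ih =>
    rw [Finset.prod_insert hj, Finset.prod_insert hj, mul_comm (raising t 0 j.succ), mul_assoc, ih,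
      mul_left_comm, evalForm_mixedForm_insert t hj, mul_assoc]

/-- By induction the letters after the first become complete functions inside B_a; they are then
pulled out one by one, each replacing a factor 1 - t e_{0j} by 1 - e_{0j}, until B_a·1 = h_a
remains. -/
theorem evalForm_wordForm [CharZero F] (t : F) (n : ℕ) (g : AddMonoidAlgebra F (Fin n → ℤ)) :
    evalForm (wordForm t 1) (raisingProd t n * g) =
      evalForm (completeForm F) (raisingProd 1 n * g) := by
  induction n with
  | zero =>
    refine evalForm_mul_congr (fun w => ?_) g
    simp [raisingProd, evalForm_single, wordForm, completeForm, vertexWord]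
  | succ n ih =>
    have h1 : ∀ g, evalForm (wordForm t 1) (consHom F n (raisingProd t n) * g) =
        evalForm (mixedForm t ∅) (consHom F n (raisingProd 1 n) * g) := by
      refine evalForm_mul_congr fun w => ?_
      obtain ⟨a, w, rfl⟩ : ∃ a v, w = Fin.cons a v := ⟨w 0, Fin.tail w, (Fin.cons_self_tail w).symm⟩
      rw [evalForm_consHom_mul _ (wordForm t 1) a (vertexOp t a),
        evalForm_consHom_mul _ (completeForm F) a (vertexOp t a), ih]
      · intro v
        simp [mixedForm, completeForm]
      · intro v
        simp [wordForm, vertexWord, List.ofFn_succ]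
    rw [raisingProd_succ, raisingProd_succ, mul_comm (∏ j, _), mul_assoc, h1, mul_left_comm,
      evalForm_mixedForm_empty, mul_assoc]
    congr 2
    funext w
    simp [mixedForm, completeForm, Fin.prod_univ_succ, vertexOp_one, mul_comm]

theorem vertexPart_eq_evalForm (t : F) (l : List ℕ) (f : SymFun F) :
    vertexPart t l f =
      evalForm (wordForm t f) (raisingProd t l.length * single (fun i => (l.get i : ℤ)) 1) := by
  have h : raisingProd t l.length =
      ∏ p ∈ Finset.univ.filter (fun p : Fin l.length × Fin l.length => p.1 < p.2),
        (1 + single (Pi.single p.1 1 - Pi.single p.2 1) (-t)) := by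
    rw [Finset.prod_finset_product _ Finset.univ (fun i => Finset.Ioi i) (by simp)]
    refine Finset.prod_congr rfl fun i _ => Finset.prod_congr rfl fun j _ => ?_
    rw [raising, AddMonoidAlgebra.single_neg, sub_eq_add_neg]
  rw [h, Finset.prod_one_add, Finset.sum_mul, map_sum, vertexPart, LinearMap.sum_apply]
  refine Finset.sum_congr rfl fun A _ => ?_
  rw [prod_single, AddMonoidAlgebra.single_mul_single, evalForm_single, Finset.prod_const, mul_one,
    LinearMap.smul_apply, wordForm]
  congr 4
  ext i
  simp only [Pi.add_apply, Finset.sum_apply, Pi.sub_apply, Finset.sum_sub_distrib, Pi.single_apply,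
    Finset.sum_boole, eq_comm (a := i)]
  ring

/-- With x_i the unit word at i, x_j - x_i = x_j (1 - x_i/x_j), and x_j is extracted once for each i
< j, hence j times. -/
theorem prod_single_pow_mul_raisingProd (n : ℕ) :
    (single (fun i : Fin n => (i : ℤ)) 1) * raisingProd (1 : F) n =
      (Matrix.vandermonde fun i : Fin n =>
        (single (Pi.single i 1) 1 : AddMonoidAlgebra F (Fin n → ℤ))).det := by
  rw [Matrix.det_vandermonde]
  have h1 : ∀ i j : Fin n, (single (Pi.single j 1) 1 - single (Pi.single i 1) 1 :
      AddMonoidAlgebra F (Fin n → ℤ)) = single (Pi.single j 1) 1 * raising 1 i j := by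
    intro i j
    rw [raising, mul_sub, mul_one, AddMonoidAlgebra.single_mul_single]
    simp
  simp only [h1, Finset.prod_mul_distrib]
  rw [raisingProd]
  congr 1
  rw [Finset.prod_comm' (t' := Finset.univ) (s' := fun j => Finset.Iio j) (by simp)]
  simp only [Finset.prod_const, Fin.card_Iio, AddMonoidAlgebra.single_pow, one_pow]
  rw [prod_single, Finset.prod_const_one]
  congr 1
  ext i
  simp [Finset.sum_apply, Pi.single_apply]

theorem evalForm_completeForm (n : ℕ) (a : Fin n → ℤ) :
    evalForm (completeForm F) (raisingProd (1 : F) n * single a 1) =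
      (Matrix.of fun i j : Fin n => complete F (a i + j - i)).det := by
  have h : raisingProd (1 : F) n * single a 1 =
      (Matrix.vandermonde fun i : Fin n =>
        (single (Pi.single i 1) 1 : AddMonoidAlgebra F (Fin n → ℤ))).det *
        single (fun i => a i - i) 1 := by
    rw [← prod_single_pow_mul_raisingProd, mul_comm (single _ _), mul_assoc,
      AddMonoidAlgebra.single_mul_single, mul_one]
    congr 2
    ext i
    simp
  -- Transposing both determinants makes σ contribute ∏ x_i^{σ(i)} on the left and ∏ h_{a_i + σ(i) -
  -- i} on the right.
  rw [h, ← Matrix.det_transpose, Matrix.det_apply, ← Matrix.det_transpose, Matrix.det_apply,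
    Finset.sum_mul, map_sum]
  refine Finset.sum_congr rfl fun σ _ => ?_
  simp only [Matrix.transpose_apply, Matrix.vandermonde_apply, AddMonoidAlgebra.single_pow, one_pow,
    Matrix.of_apply]
  rw [prod_single, Finset.prod_const_one, smul_mul_assoc, AddMonoidAlgebra.single_mul_single, mul_one,
    Units.smul_def, Units.smul_def, map_zsmul, evalForm_single, one_smul, completeForm]
  congr 1
  refine Finset.prod_congr rfl fun i _ => ?_
  congr 1
  simp [Finset.sum_apply, Pi.single_apply]
  ring

end GroupRing

/-- The operator `B_λ` creates the Schur function `s_λ`. -/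
theorem vertexPart_one {F : Type*} [Field F] [CharZero F] (t : F) (l : List ℕ) :
    vertexPart t l 1 = schur F l := by
  rw [vertexPart_eq_evalForm, evalForm_wordForm, evalForm_completeForm, schur]

/-! ### Lexicographic order on integer words -/

section Words

theorem append_lt_append_left {u v : List ℤ} (w : List ℤ) (h : u < v) : w ++ u < w ++ v := by
  induction w with
  | nil => exact h
  | cons a w ih => exact List.cons_lt_cons_iff.mpr (Or.inr ⟨rfl, ih⟩)

theorem append_lt_append_of_length_eq {u v : List ℤ} (hl : v.length = u.length) (w w' : List ℤ)
    (h : u < v) : u ++ w < v ++ w' := by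
  induction u generalizing v with
  | nil => simp_all
  | cons a u ih =>
    rcases v with _ | ⟨b, v⟩
    · simp at hl
    · rw [List.cons_append, List.cons_append, List.cons_lt_cons_iff]
      rcases List.cons_lt_cons_iff.mp h with h' | ⟨rfl, h'⟩
      · exact Or.inl h'
      · exact Or.inr ⟨rfl, ih (by simpa using hl) h'⟩

theorem headD_le_of_lt {u v : List ℤ} (hl : v.length = u.length) (h : u < v) :
    u.headD 0 ≤ v.headD 0 := by
  rcases u with _ | ⟨a, u⟩
  · simp_all
  rcases v with _ | ⟨b, v⟩
  · simp at hl
  rcases List.cons_lt_cons_iff.mp h with h | ⟨rfl, h⟩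
  · exact h.le
  · exact le_rfl

/-- Induction on words of a fixed length with bounded letters, from large to small words in the
lexicographic order. -/
theorem lex_induction {k : ℤ} (n : ℕ) (P : List ℤ → Prop)
    (h : ∀ β : List ℤ, β.length = n → (∀ x ∈ β, x ≤ k) →
      (∀ β' : List ℤ, β'.length = n → (∀ x ∈ β', x ≤ k) → β < β' → P β') → P β)
    (β : List ℤ) (hβ : β.length = n) (hk : ∀ x ∈ β, x ≤ k) : P β := by
  induction n generalizing P β with
  | zero =>
    refine h β hβ hk fun β' hβ' _ hlt => ?_
    simp_all
  | succ n ih =>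
    -- Here m is the distance of the first letter from k: a larger first letter decreases m, and an
    -- equal one is left to the induction on the tail.
    have key : ∀ m : ℕ, ∀ b : ℤ, (k - b).toNat = m → b ≤ k → ∀ γ : List ℤ, γ.length = n →
        (∀ x ∈ γ, x ≤ k) → P (b :: γ) := by
      intro m
      induction m using Nat.strong_induction_on with
      | _ m ihm =>
        intro b hb hbk
        refine ih (fun γ => P (b :: γ)) fun γ hγ hγk hγP => ?_
        refine h (b :: γ) (by simp [hγ]) (by simpa using ⟨hbk, hγk⟩) fun β' hl' hk' hlt => ?_
        rcases β' with _ | ⟨b', γ'⟩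
        · simp at hl'
        have hl : γ'.length = n := by simpa using hl'
        have hb' : b' ≤ k := hk' b' (by simp)
        have hγ' : ∀ x ∈ γ', x ≤ k := fun x hx => hk' x (by simp [hx])
        rcases List.cons_lt_cons_iff.mp hlt with h' | ⟨rfl, h'⟩
        · exact ihm _ (by omega) b' rfl hb' γ' hl hγ'
        · exact hγP γ' hl hγ' h'
    rcases β with _ | ⟨b, γ⟩
    · simp at hβ
    exact key _ b rfl (hk b (by simp)) γ (by simpa using hβ) fun x hx => hk x (by simp [hx])

theorem pairwise_or_exists_ascent (β : List ℤ) :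
    β.Pairwise (fun a b => b ≤ a) ∨ ∃ u m n w, β = u ++ m :: n :: w ∧ m < n := by
  induction β with
  | nil => simp
  | cons a β ih =>
    rcases ih with ih | ⟨u, m, n, w, rfl, h⟩
    · rcases β with _ | ⟨b, β⟩
      · simp
      rcases lt_or_ge a b with hab | hab
      · exact Or.inr ⟨[], a, b, β, rfl, hab⟩
      · refine Or.inl (List.pairwise_cons.mpr ⟨fun x hx => ?_, ih⟩)
        rcases List.mem_cons.mp hx with rfl | hx
        · exact hab
        · exact (List.rel_of_pairwise_cons ih hx).trans hab
    · exact Or.inr ⟨a :: u, m, n, w, rfl, h⟩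

end Words

/-! ### Unitriangularity of B_λ and G_λ over words -/

section Expansion

variable {F : Type*} [Field F] (t : F)

theorem vertexWord_nil : vertexWord t [] = 1 := rfl

theorem vertexWord_cons (a : ℤ) (β : List ℤ) (f : SymFun F) :
    vertexWord t (a :: β) f = vertexOp t a (vertexWord t β f) := by
  simp [vertexWord]

theorem vertexWord_append (β γ : List ℤ) (f : SymFun F) :
    vertexWord t (β ++ γ) f = vertexWord t β (vertexWord t γ f) := by
  simp [vertexWord]

theorem hallLittlewood_eq (l : List ℕ) :
    hallLittlewood t l = vertexWord t (l.map Nat.cast) 1 := by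
  rw [hallLittlewood, List.map_id']
  congr 2
  exact List.flatMap_pure_eq_map _ _

/-- The pairs of positions `i < j` in a word of length `n`. -/
abbrev pairs (n : ℕ) : Finset (Fin n × Fin n) := Finset.univ.filter fun p => p.1 < p.2

/-- The word obtained from `λ` by the raising operators `e_{ij}`, `(i,j) ∈ A`. -/
def raisedWord (l : List ℕ) (A : Finset (Fin l.length × Fin l.length)) : List ℤ :=
  List.ofFn fun i : Fin l.length =>
      (l.get i : ℤ) + ((A.filter fun p => p.1 = i).card : ℤ)
        - ((A.filter fun p => p.2 = i).card : ℤ)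

theorem vertexPart_apply (l : List ℕ) (f : SymFun F) :
    vertexPart t l f =
      ∑ A ∈ (pairs l.length).powerset, (-t) ^ A.card • vertexWord t (raisedWord l A) f := by
  simp [vertexPart, raisedWord, LinearMap.sum_apply]

theorem le_of_mem_raisedWord {l : List ℕ} {A : Finset (Fin l.length × Fin l.length)}
    (hA : A ⊆ pairs l.length) {k : ℤ} (hk : ∀ x ∈ l, (x : ℤ) + l.length ≤ k + 1) :
    ∀ x ∈ raisedWord l A, x ≤ k := by
  intro x hx
  obtain ⟨i, rfl⟩ := (List.mem_ofFn' _ _).mp hx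
  have h1 := hk (l.get i) (List.get_mem _ _)
  -- Letter i is raised at most once for each other position, so by at most ℓ - 1.
  have h2 : (A.filter fun p => p.1 = i).card ≤ (Finset.univ.erase i).card := by
    refine Finset.card_le_card_of_injOn Prod.snd (fun p hp => ?_) fun p hp q hq h => ?_
    · rw [Finset.mem_coe, Finset.mem_filter] at hp
      have := (Finset.mem_filter.mp (hA hp.1)).2
      rw [hp.2] at this
      simp [this.ne']
    · rw [Finset.mem_coe, Finset.mem_filter] at hp hq
      exact Prod.ext (hp.2.trans hq.2.symm) h
  rw [Finset.card_erase_of_mem (Finset.mem_univ _), Finset.card_univ, Fintype.card_fin] at h2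
  have := i.pos
  simp only
  omega

theorem vertexPart_nil (f : SymFun F) : vertexPart t [] f = f := by
  rw [vertexPart_apply]
  have : (pairs ([] : List ℕ).length) = ∅ := by
    ext p
    exact p.1.elim0
  rw [this, Finset.powerset_empty, Finset.sum_singleton]
  simp [raisedWord, vertexWord]

/-- The raising operators which do not involve the first letter. -/
theorem sum_filter_eq_vertexOp (a : ℕ) (l : List ℕ) (f : SymFun F) :
    ∑ A ∈ (pairs (a :: l).length).powerset.filter (fun A => ∀ p ∈ A, p.1.val ≠ 0),
      (-t) ^ A.card • vertexWord t (raisedWord (a :: l) A) f = vertexOp t a (vertexPart t l f) := by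
  rw [vertexPart_apply, map_sum]
  let e : Fin l.length × Fin l.length ↪ Fin (l.length + 1) × Fin (l.length + 1) :=
    (Fin.succEmb _).prodMap (Fin.succEmb _)
  symm
  refine Finset.sum_nbij (fun A => A.map e) (fun A hA => ?_)
    (fun A _ B _ h => Finset.map_injective e h) (fun A hA => ?_) fun A hA => ?_
  · rw [Finset.mem_filter, Finset.mem_powerset]
    rw [Finset.mem_powerset] at hA
    constructor
    · intro p hp
      obtain ⟨q, hq, rfl⟩ := Finset.mem_map.mp hp
      have := (Finset.mem_filter.mp (hA hq)).2
      exact Finset.mem_filter.mpr ⟨Finset.mem_univ _, Fin.succ_lt_succ_iff.mpr this⟩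
    · intro p hp
      obtain ⟨q, hq, rfl⟩ := Finset.mem_map.mp hp
      simp [e]
  · rw [Finset.mem_coe, Finset.mem_filter, Finset.mem_powerset] at hA
    obtain ⟨hA, h0⟩ := hA
    refine ⟨Finset.univ.filter fun p => e p ∈ A, ?_, ?_⟩
    · rw [Finset.mem_coe, Finset.mem_powerset]
      intro p hp
      have := (Finset.mem_filter.mp (hA (Finset.mem_filter.mp hp).2)).2
      exact Finset.mem_filter.mpr ⟨Finset.mem_univ _, Fin.succ_lt_succ_iff.mp this⟩
    · ext p
      simp only [Finset.mem_map, Finset.mem_filter, Finset.mem_univ, true_and]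
      constructor
      · rintro ⟨q, hq, rfl⟩
        exact hq
      · intro hp
        have h1 : (p.1 : ℕ) < p.2 := (Finset.mem_filter.mp (hA hp)).2
        have h2 := h0 p hp
        have h3 : e (Fin.pred p.1 (fun h => h2 (by rw [h]; rfl)),
            Fin.pred p.2 (fun h => by rw [h] at h1; simp at h1)) = p := by
          ext <;> simp [e]
        exact ⟨_, by rwa [h3], h3⟩
  · rw [map_smul, Finset.card_map, ← vertexWord_cons]
    congr 3
    rw [raisedWord, raisedWord]
    refine Eq.trans ?_ (List.ofFn_succ (n := l.length) (f := fun i : Fin (l.length + 1) =>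
      ((a :: l).get i : ℤ) + (((A.map e).filter fun p => p.1 = i).card : ℤ)
        - (((A.map e).filter fun p => p.2 = i).card : ℤ))).symm
    congr 1
    · simp [Finset.filter_map, e, Function.comp_def, Fin.succ_ne_zero]
    · congr 1
      funext i
      simp [Finset.filter_map, e, Function.comp_def]

/-- The words that occur in `B_{(a, l)} - B_a B_l`. -/
theorem vertexPart_cons_sub_mem {k : ℤ} (a : ℕ) (l : List ℕ)
    (hk : ∀ x ∈ a :: l, (x : ℤ) + (a :: l).length ≤ k + 1) (f : SymFun F) :
    vertexPart t (a :: l) f - vertexOp t a (vertexPart t l f) ∈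
      Submodule.span F {g | ∃ (b : ℤ) (β : List ℤ), (a : ℤ) < b ∧ β.length = l.length ∧
        (∀ x ∈ b :: β, x ≤ k) ∧ g = vertexWord t (b :: β) f} := by
  rw [vertexPart_apply, ← sum_filter_eq_vertexOp,
    ← Finset.sum_filter_add_sum_filter_not _ (fun A => ∀ p ∈ A, p.1.val ≠ 0), add_sub_cancel_left]
  refine Submodule.sum_mem _ fun A hA => Submodule.smul_mem _ _ (Submodule.subset_span ?_)
  rw [Finset.mem_filter, Finset.mem_powerset] at hA
  obtain ⟨hA, h0⟩ := hA
  push Not at h0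
  obtain ⟨p, hp, hp0⟩ := h0
  have hw : raisedWord (a :: l) A = _ := List.ofFn_succ (n := l.length)
    (f := fun i : Fin (l.length + 1) =>
      ((a :: l).get i : ℤ) + ((A.filter fun p => p.1 = i).card : ℤ)
        - ((A.filter fun p => p.2 = i).card : ℤ))
  have hb := le_of_mem_raisedWord hA hk
  rw [hw] at hb ⊢
  refine ⟨_, _, ?_, List.length_ofFn, hb, rfl⟩
  have h1 : 0 < (A.filter fun p => p.1 = (0 : Fin (l.length + 1))).card :=
    Finset.card_pos.mpr ⟨p, Finset.mem_filter.mpr ⟨hp, Fin.ext hp0⟩⟩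
  -- No pair i < j ends at position 0, so the first letter is never lowered.
  have h2 : (A.filter fun p => p.2 = (0 : Fin (l.length + 1))) = ∅ := by
    refine Finset.filter_eq_empty_iff.mpr fun q hq hq0 => ?_
    have := (Finset.mem_filter.mp (hA hq)).2
    rw [hq0] at this
    exact absurd this (Fin.not_lt_zero _)
  rw [h2]
  simp only [List.get_eq_getElem, Fin.val_zero, List.getElem_cons_zero, Finset.card_empty]
  omega

/-- The span of the `B_{β'} f` where `β'` is a word of the same length as `β` that is
lexicographically larger and has letters at most `k`. -/
noncomputable def upperSpan (k : ℤ) (β : List ℤ) (f : SymFun F) : Submodule F (SymFun F) :=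
  Submodule.span F {g | ∃ β' : List ℤ, β'.length = β.length ∧ (∀ x ∈ β', x ≤ k) ∧ β < β' ∧
    g = vertexWord t β' f}

theorem vertexWord_mem_upperSpan {k : ℤ} {β β' : List ℤ} (h : β'.length = β.length)
    (hk : ∀ x ∈ β', x ≤ k) (hlt : β < β') (f : SymFun F) :
    vertexWord t β' f ∈ upperSpan t k β f :=
  Submodule.subset_span ⟨β', h, hk, hlt, rfl⟩

/-- One passes from B_{(a,l)} to B_a B_l, which costs words with first letter above a, and then from
B_l to its leading word behind the fixed letter a. -/
theorem vertexPart_sub_mem_upperSpan {k : ℤ} (l : List ℕ)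
    (hk : ∀ x ∈ l, (x : ℤ) + l.length ≤ k + 1) (f : SymFun F) :
    vertexPart t l f - vertexWord t (l.map Nat.cast) f ∈ upperSpan t k (l.map Nat.cast) f := by
  induction l with
  | nil => simp [vertexPart_nil, vertexWord_nil]
  | cons a l ih =>
    have hl : ∀ x ∈ l, (x : ℤ) + l.length ≤ k + 1 := fun x hx => by
      have := hk x (by simp [hx])
      rw [List.length_cons] at this
      push_cast at this
      omega
    have ha : (a : ℤ) ≤ k := by
      have := hk a (by simp)
      rw [List.length_cons] at this
      push_cast at this
      omega
    rw [List.map_cons, vertexWord_cons,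
      ← sub_add_sub_cancel _ (vertexOp t a (vertexPart t l f)), ← map_sub]
    refine Submodule.add_mem _ ?_ ?_
    · refine Submodule.span_mono ?_ (vertexPart_cons_sub_mem t a l hk f)
      rintro g ⟨b, β, hab, hβ, hβk, rfl⟩
      exact ⟨b :: β, by simp [hβ], hβk, List.cons_lt_cons_iff.mpr (Or.inl hab), rfl⟩
    · have : upperSpan t k (l.map Nat.cast) f ≤
          (upperSpan t k ((a : ℤ) :: l.map Nat.cast) f).comap (vertexOp t a) := by
        refine Submodule.span_le.mpr ?_
        rintro g ⟨β, hβ, hβk, hlt, rfl⟩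
        rw [SetLike.mem_coe, Submodule.mem_comap, ← vertexWord_cons]
        refine vertexWord_mem_upperSpan t (by simp [hβ]) ?_
          (List.cons_lt_cons_iff.mpr (Or.inr ⟨rfl, hlt⟩)) f
        intro x hx
        rcases List.mem_cons.mp hx with rfl | hx
        exacts [ha, hβk x hx]
      exact this (ih hl)

theorem genSchur_sub_mem_upperSpan {k : ℤ} (S : List (List ℕ))
    (hk : ∀ p ∈ S, ∀ x ∈ p, (x : ℤ) + p.length ≤ k + 1) :
    genSchur t S - vertexWord t (S.flatten.map Nat.cast) 1 ∈
      upperSpan t k (S.flatten.map Nat.cast) 1 := by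
  induction S with
  | nil => simp [genSchur, vertexWord_nil]
  | cons p S ih =>
    have hp := hk p (by simp)
    have hS : ∀ p ∈ S, ∀ x ∈ p, (x : ℤ) + p.length ≤ k + 1 := fun q hq => hk q (by simp [hq])
    have hpk : ∀ x ∈ p.map (Nat.cast : ℕ → ℤ), x ≤ k := by
      intro x hx
      obtain ⟨y, hy, rfl⟩ := List.mem_map.mp hx
      have := hp y hy
      have := List.length_pos_of_mem hy
      omega
    have hSk : ∀ x ∈ S.flatten.map (Nat.cast : ℕ → ℤ), x ≤ k := by
      intro x hx
      obtain ⟨y, hy, rfl⟩ := List.mem_map.mp hx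
      obtain ⟨q, hq, hy⟩ := List.mem_flatten.mp hy
      have := hS q hq y hy
      have := List.length_pos_of_mem hy
      omega
    specialize ih hS
    set γ := S.flatten.map (Nat.cast : ℕ → ℤ) with hγ
    have hflat : (p :: S).flatten.map (Nat.cast : ℕ → ℤ) = p.map Nat.cast ++ γ := by simp [hγ]
    rw [hflat, genSchur, vertexWord_append,
      ← sub_add_sub_cancel _ (vertexWord t (p.map Nat.cast) (genSchur t S)), ← map_sub]
    refine Submodule.add_mem _ ?_ ?_
    · refine Submodule.span_le.mpr ?_ (vertexPart_sub_mem_upperSpan t p hp (genSchur t S))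
      rintro g ⟨β, hβ, hβk, hlt, rfl⟩
      -- Once the prefix β exceeds that of p, any suffix may follow, so both the leading word and
      -- the upper words of the remaining pieces are allowed.
      rw [SetLike.mem_coe, ← sub_add_cancel (genSchur t S) (vertexWord t γ 1), map_add]
      refine Submodule.add_mem _ ?_ ?_
      · have : upperSpan t k γ 1 ≤
            (upperSpan t k (p.map Nat.cast ++ γ) 1).comap (vertexWord t β) := by
          refine Submodule.span_le.mpr ?_
          rintro g ⟨β', hβ', hβk', hlt', rfl⟩
          rw [SetLike.mem_coe, Submodule.mem_comap, ← vertexWord_append]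
          refine vertexWord_mem_upperSpan t (by simp [hβ, hβ']) ?_
            (append_lt_append_of_length_eq hβ _ _ hlt) 1
          intro x hx
          rcases List.mem_append.mp hx with hx | hx
          exacts [hβk x hx, hβk' x hx]
        exact this ih
      · rw [← vertexWord_append]
        refine vertexWord_mem_upperSpan t (by simp [hβ]) ?_
          (append_lt_append_of_length_eq hβ _ _ hlt) 1
        intro x hx
        rcases List.mem_append.mp hx with hx | hx
        exacts [hβk x hx, hSk x hx]
    · have : upperSpan t k γ 1 ≤
          (upperSpan t k (p.map Nat.cast ++ γ) 1).comap (vertexWord t (p.map Nat.cast)) := by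
        refine Submodule.span_le.mpr ?_
        rintro g ⟨β', hβ', hβk', hlt', rfl⟩
        rw [SetLike.mem_coe, Submodule.mem_comap, ← vertexWord_append]
        refine vertexWord_mem_upperSpan t (by simp [hβ']) ?_ (append_lt_append_left _ hlt') 1
        intro x hx
        rcases List.mem_append.mp hx with hx | hx
        exacts [hpk x hx, hβk' x hx]
      exact this ih

/-- A piece of main hook-length at most `k`. -/
theorem add_length_le_of_mainHook_le {k : ℕ} {p : List ℕ} (hp : IsPartition p)
    (h : mainHook p ≤ k) : ∀ x ∈ p, (x : ℤ) + p.length ≤ (k : ℤ) + 1 := by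
  intro x hx
  rcases p with _ | ⟨a, p⟩
  · simp at hx
  have ha := hp.2 a (by simp)
  have hxa : x ≤ a := by
    rcases List.mem_cons.mp hx with rfl | hx
    · exact le_rfl
    · exact List.rel_of_pairwise_cons hp.1 hx
  rw [mainHook] at h
  rw [List.length_cons]
  push_cast
  omega

theorem splitPoly_sub_mem_upperSpan {k : ℕ} {l : List ℕ} (hl : IsBounded k l) :
    splitPoly t k l - hallLittlewood t l ∈ upperSpan t k (l.map Nat.cast) 1 := by
  have hmem : ∀ a ∈ l, 0 < a ∧ a ≤ k := by
    intro a ha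
    refine ⟨hl.1.2 a ha, ?_⟩
    rcases l with _ | ⟨b, l⟩
    · simp at ha
    have hb : b ≤ k := hl.2
    rcases List.mem_cons.mp ha with rfl | ha
    · exact hb
    · exact (List.rel_of_pairwise_cons hl.1.1 ha).trans hb
  have h := genSchur_sub_mem_upperSpan t (k := k) (kSplit k l) fun p hp => by
    refine add_length_le_of_mainHook_le ⟨?_, fun a ha => ?_⟩ (mainHook_le_of_mem_kSplit hmem p hp)
    · have := hl.1.1
      rw [← kSplit_flatten k l] at this
      exact (List.pairwise_flatten.mp this).1 p hp
    · have : a ∈ (kSplit k l).flatten := List.mem_flatten.mpr ⟨p, hp, ha⟩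
      rw [kSplit_flatten] at this
      exact (hmem a this).1
  rwa [kSplit_flatten, ← hallLittlewood_eq] at h

end Expansion

/-! ### Straightening words applied to 1 -/

section Straightening

variable {F : Type*} [Field F] [CharZero F] (t : F)

/-- A product of vertex operators with indices at most `k`, applied to `1`, lies in a subspace that
is closed under straightening. -/
theorem vertexWord_one_mem {k : ℕ} {c : ℤ} {V : Submodule F (SymFun F)}
    (hV : ∀ l, IsBounded k l → c ≤ firstPart l → upperSpan t k (l.map Nat.cast) 1 ≤ V →
      hallLittlewood t l ∈ V)
    (β : List ℤ) (hk : ∀ x ∈ β, x ≤ k) (hc : c ≤ β.headD 0) : vertexWord t β 1 ∈ V := by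
  induction hn : β.length using Nat.strong_induction_on generalizing β with
  | _ n ihn =>
    refine lex_induction (k := k) n (fun β => c ≤ β.headD 0 → vertexWord t β 1 ∈ V) ?_ β hn hk hc
    clear hc hk hn β
    intro β hn hk ih hc
    -- Among words of one length, a lexicographically larger one has at least as large a first
    -- letter, so the bound c survives.
    have hup : ∀ β' : List ℤ, β'.length = n → (∀ x ∈ β', x ≤ k) → β < β' → vertexWord t β' 1 ∈ V :=
      fun β' h1 h2 h3 => ih β' h1 h2 h3 (hc.trans (headD_le_of_lt (h1.trans hn.symm) h3))
    rcases pairwise_or_exists_ascent β with hs | ⟨u, m, m', w, rfl, hlt⟩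
    · rcases List.eq_nil_or_concat' β with rfl | ⟨γ, x, rfl⟩
      · refine hV [] ⟨⟨by simp, by simp⟩, by simp [firstPart]⟩ (by simpa [firstPart] using hc) ?_
        refine Submodule.span_le.mpr ?_
        rintro g ⟨β', h1, h2, h3, rfl⟩
        exact hup β' (h1.trans hn) h2 h3
      have hx1 : vertexWord t [x] (1 : SymFun F) = complete F x := by
        rw [vertexWord_cons, vertexWord_nil, Module.End.one_apply, vertexOp_one]
      -- The last letter acts by B_x·1 = h_x: the word vanishes for x < 0, loses a letter for x = 0,
      -- and is a partition for x > 0.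
      rcases lt_trichotomy x 0 with hx | rfl | hx
      · rw [vertexWord_append, hx1, complete_of_neg hx, map_zero]
        exact V.zero_mem
      · rw [vertexWord_append, hx1, complete_zero]
        refine ihn γ.length (by simp [← hn]) γ (fun y hy => hk y (by simp [hy])) ?_ rfl
        rcases γ with _ | ⟨a, γ⟩
        · simpa using hc
        · simpa using hc
      · have hpos : ∀ y ∈ γ ++ [x], 0 < y := by
          intro y hy
          rcases List.mem_append.mp hy with h | h
          · exact hx.trans_le ((List.pairwise_append.mp hs).2.2 y h x (by simp))
          · rw [List.mem_singleton] at h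
            rwa [h]
        obtain ⟨l, hl⟩ : ∃ l : List ℕ, γ ++ [x] = l.map Nat.cast := by
          refine ⟨(γ ++ [x]).map Int.toNat, ?_⟩
          rw [List.map_map]
          refine (List.map_id _).symm.trans (List.map_congr_left fun y hy => ?_)
          have := hpos y hy
          simp [this.le]
        rw [hl] at hs hk hpos hc hup hn ⊢
        rw [← hallLittlewood_eq]
        refine hV l ⟨⟨?_, ?_⟩, ?_⟩ ?_ ?_
        · rw [List.pairwise_map] at hs
          exact hs.imp fun h => by exact_mod_cast h
        · intro a ha
          exact_mod_cast hpos a (List.mem_map_of_mem ha)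
        · rcases l with _ | ⟨a, l⟩
          · simp [firstPart]
          · exact_mod_cast hk a (by simp)
        · rcases l with _ | ⟨a, l⟩
          · simpa [firstPart] using hc
          · simpa [firstPart] using hc
        · refine Submodule.span_le.mpr ?_
          rintro g ⟨β', h1, h2, h3, rfl⟩
          exact hup β' (h1.trans hn) h2 h3
    -- At an ascent m < m', every word produced by the commutation relation has a letter above m in
    -- the first place and no new letter above m'.
    · have h2 : ∀ p q : ℤ, m < p → p ≤ m' → q ≤ m' → vertexWord t (u ++ p :: q :: w) 1 ∈ V := by
        intro p q hp hpm hqm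
        have hm' : m' ≤ k := hk m' (by simp)
        refine hup _ (by simpa using hn) (fun x hx => ?_)
          (append_lt_append_left u (List.cons_lt_cons_iff.mpr (Or.inl hp)))
        simp only [List.mem_append, List.mem_cons] at hx
        rcases hx with hx | rfl | rfl | hx
        · exact hk x (by simp [hx])
        · omega
        · omega
        · exact hk x (by simp [hx])
      rcases (show m + 1 ≤ m' from hlt).eq_or_lt with rfl | hlt'
      · have := h2 (m + 1) m hlt le_rfl hlt.le
        rw [vertexWord_append, vertexWord_cons, vertexWord_cons] at this ⊢
        rw [vertexOp_swap_succ, map_smul]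
        exact V.smul_mem _ this
      · have e1 := h2 m' m hlt le_rfl hlt.le
        have e2 := h2 (m + 1) (m' - 1) (by omega) (by omega) (by omega)
        have e3 := h2 (m' - 1) (m + 1) (by omega) (by omega) (by omega)
        rw [vertexWord_append, vertexWord_cons, vertexWord_cons] at e1 e2 e3 ⊢
        rw [vertexOp_swap, map_sub, map_add, map_smul, map_smul]
        exact V.sub_mem (V.add_mem (V.smul_mem _ e1) (V.smul_mem _ e2)) e3

theorem hallLittlewood_mem_boundedSpace {F : Type*} [Field F] (t : F) {k : ℕ} {l : List ℕ}
    (hl : IsBounded k l) : hallLittlewood t l ∈ boundedSpace t k :=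
  Submodule.subset_span ⟨l, hl, rfl⟩

theorem vertexWord_one_mem_boundedSpace {k : ℕ} (β : List ℤ) (hk : ∀ x ∈ β, x ≤ k) :
    vertexWord t β 1 ∈ boundedSpace t k :=
  vertexWord_one_mem t (c := β.headD 0)
    (fun _ hl _ _ => hallLittlewood_mem_boundedSpace t hl) β hk le_rfl

theorem upperSpan_le_boundedSpace (k : ℕ) (β : List ℤ) :
    upperSpan t k β 1 ≤ boundedSpace t k := by
  refine Submodule.span_le.mpr ?_
  rintro g ⟨β', -, h2, -, rfl⟩
  exact vertexWord_one_mem_boundedSpace t β' h2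

theorem splitPoly_mem_boundedSpace {k : ℕ} {l : List ℕ} (hl : IsBounded k l) :
    splitPoly t k l ∈ boundedSpace t k := by
  rw [← sub_add_cancel (splitPoly t k l) (hallLittlewood t l)]
  exact Submodule.add_mem _ (upperSpan_le_boundedSpace t k _ (splitPoly_sub_mem_upperSpan t hl))
    (hallLittlewood_mem_boundedSpace t hl)

/-- The span of the `k`-split polynomials of the `k`-bounded partitions with first part at
least `c`. -/
noncomputable def splitSpan (k : ℕ) (c : ℤ) : Submodule F (SymFun F) :=
  Submodule.span F {g | ∃ l, IsBounded k l ∧ c ≤ firstPart l ∧ g = splitPoly t k l}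

/-- Triangularity makes H_λ equal to G_λ minus upper words, which is the closure property that the
straightening induction requires. -/
theorem vertexWord_one_mem_splitSpan {k : ℕ} {c : ℤ} (β : List ℤ) (hk : ∀ x ∈ β, x ≤ k)
    (hc : c ≤ β.headD 0) : vertexWord t β 1 ∈ splitSpan t k c := by
  refine vertexWord_one_mem t (fun l hl hcl hup => ?_) β hk hc
  rw [← sub_sub_cancel (splitPoly t k l) (hallLittlewood t l)]
  have h : splitPoly t k l ∈ splitSpan t k c := Submodule.subset_span ⟨l, hl, hcl, rfl⟩
  exact Submodule.sub_mem _ h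
    (hup (splitPoly_sub_mem_upperSpan t hl))

end Straightening

/-! ### Setting large complete functions to zero -/

section Truncation

variable {F : Type*} [Field F]

/-- The images of the power sums under the homomorphism with prescribed images of the complete
symmetric functions. -/
noncomputable def powerImage {R : Type*} [CommRing R] (c : ℕ → R) : ℕ → R
  | n => (n + 1) * c (n + 1) - ∑ i : Fin n, powerImage c i * c (n - i)
decreasing_by exact i.2

/-- The homomorphism with prescribed images of the complete symmetric functions. -/
noncomputable def liftComplete (F : Type*) [Field F] {R : Type*} [CommRing R] [Algebra F R]
    (c : ℕ → R) : SymFun F →ₐ[F] R :=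
  aeval fun r : ℕ+ => powerImage c r.natPred

/-- `powerImage` is Newton's identity solved for p_{n+1}, so applying the homomorphism to that
identity recovers the prescribed value of h_{n+1}. -/
theorem liftComplete_completeNat [CharZero F] {R : Type*} [CommRing R] [Algebra F R]
    (c : ℕ → R) (h0 : c 0 = 1) (n : ℕ) : liftComplete F c (completeNat F n) = c n := by
  induction n using Nat.strong_induction_on with
  | _ n ih =>
    rcases n with _ | n
    · rw [completeNat, map_one, h0]
    have hne : (n + 1 : F) ≠ 0 := by exact_mod_cast n.succ_ne_zero
    have hu : IsUnit (algebraMap F R (n + 1)) := (IsUnit.mk0 _ hne).map _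
    refine hu.mul_left_cancel ?_
    have h := congrArg (liftComplete F c) (succ_mul_completeNat (F := F) n)
    have hC : liftComplete F c (C (n + 1 : F)) = algebraMap F R (n + 1) := by
      rw [liftComplete, aeval_C]
    rw [map_mul, hC] at h
    rw [h, map_sum, Finset.sum_range_succ]
    have hX : ∀ i : ℕ, liftComplete F c (X i.succPNat) = powerImage c i := by
      intro i
      rw [liftComplete, aeval_X, Nat.natPred_succPNat]
    have hlow : ∀ i ∈ Finset.range n, liftComplete F c (X i.succPNat * completeNat F (n - i)) =
        powerImage c i * c (n - i) := by
      intro i hi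
      rw [map_mul, hX, ih _ (by omega)]
    rw [Finset.sum_congr rfl hlow, map_mul, hX, Nat.sub_self, completeNat, map_one, mul_one,
      powerImage, Fin.sum_univ_eq_sum_range (fun i => powerImage c i * c (n - i)) n]
    simp

/-- The homomorphism to the polynomial ring in `h_1, …, h_a` that sends the other complete symmetric
functions to `0`. -/
noncomputable def truncate (F : Type*) [Field F] (a : ℕ) : SymFun F →ₐ[F] MvPolynomial ℕ F :=
  (aeval fun n : ℕ => if n ≤ a then (X n : MvPolynomial ℕ F) else 0).comp
    (liftComplete F fun n => if n = 0 then 1 else X n)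

theorem truncate_complete [CharZero F] {a : ℕ} {n : ℤ} (hn : 0 < n) :
    truncate F a (complete F n) = if n ≤ a then X n.toNat else 0 := by
  obtain ⟨n, rfl⟩ := Int.eq_ofNat_of_zero_le hn.le
  rw [complete_natCast, truncate, AlgHom.comp_apply, liftComplete_completeNat _ (by simp),
    if_neg (by omega), aeval_X]
  simp

theorem truncate_eq_zero_of_succ {a : ℕ} {f : SymFun F} (h : truncate F (a + 1) f = 0) :
    truncate F a f = 0 := by
  have key : (aeval fun n : ℕ => if n ≤ a then (X n : MvPolynomial ℕ F) else 0).comp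
      (truncate F (a + 1)) = truncate F a := by
    rw [truncate, truncate, ← AlgHom.comp_assoc]
    congr 1
    refine MvPolynomial.algHom_ext fun n => ?_
    rw [AlgHom.comp_apply, aeval_X, aeval_X]
    split_ifs with h1 h2 h2
    · rw [aeval_X, if_pos h2]
    · rw [aeval_X, if_neg h2]
    · omega
    · rw [map_zero]
  rw [← key, AlgHom.comp_apply, h, map_zero]

variable (t : F)

/-- Every term of B_b carries a factor h_{i+b} with i ≥ 0, which is truncated away; for b = a only
the term i = 0 survives. -/
theorem truncate_vertexOp_of_lt [CharZero F] {a : ℕ} {b : ℤ} (h : a < b) (f : SymFun F) :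
    truncate F a (vertexOp t b f) = 0 := by
  obtain ⟨N, hN⟩ := exists_skewOp_eq_zero t f
  rw [vertexOp_apply t b f hN, map_sum]
  refine Finset.sum_eq_zero fun i _ => ?_
  rw [map_mul, truncate_complete (by omega), if_neg (by omega), zero_mul]

theorem truncate_vertexOp_self [CharZero F] {a : ℕ} (ha : 0 < a) (f : SymFun F) :
    truncate F a (vertexOp t a f) = X a * truncate F a f := by
  obtain ⟨N, hN⟩ := exists_skewOp_eq_zero t f
  rw [vertexOp_apply t a f (N := N + 1) fun i hi => hN i (by push_cast at hi; omega), map_sum,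
    Finset.sum_range_succ', Finset.sum_eq_zero, zero_add, map_mul, truncate_complete (by omega),
    if_pos (by simp), Nat.cast_zero, skewOp_zero]
  · simp
  · intro i _
    rw [map_mul, truncate_complete (by omega), if_neg (by omega), zero_mul]

end Truncation

/-! ### Independence of the G_λ, the projections, and the conclusion -/

section Independence

variable {F : Type*} [Field F] (t : F)

/-- The variant of the `k`-split polynomial whose first piece consists of the first `m` parts. -/
noncomputable def prefixSplitPoly (k m : ℕ) (l : List ℕ) : SymFun F :=
  vertexPart t (l.take m) (splitPoly t k (l.drop m))

theorem prefixSplitPoly_nil (k m : ℕ) : prefixSplitPoly t k m [] = 1 := by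
  rw [prefixSplitPoly, List.take_nil, List.drop_nil, vertexPart_nil, splitPoly, kSplit, genSchur]

theorem prefixSplitPoly_zero (k : ℕ) (l : List ℕ) : prefixSplitPoly t k 0 l = splitPoly t k l := by
  rw [prefixSplitPoly, List.take_zero, List.drop_zero, vertexPart_nil]

theorem splitPoly_cons (k a : ℕ) (l : List ℕ) :
    splitPoly t k (a :: l) = prefixSplitPoly t k (k - a + 1) (a :: l) := by
  rw [splitPoly, kSplit, genSchur]
  rfl

variable [CharZero F]

theorem vertexPart_cons_sub_mem_ker (a : ℕ) (l : List ℕ) (f : SymFun F) (c : ℕ) (hc : c ≤ a) :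
    truncate F c (vertexPart t (a :: l) f - vertexOp t a (vertexPart t l f)) = 0 := by
  -- Only the first letters of the words matter here, so any upper bound on the letters will do.
  have hk : ∀ x ∈ a :: l, (x : ℤ) + (a :: l).length ≤ ((a :: l).sum + (a :: l).length : ℤ) + 1 := by
    intro x hx
    have : x ≤ (a :: l).sum := List.le_sum_of_mem hx
    have h' : (x : ℤ) ≤ ((a :: l).sum : ℕ) := by exact_mod_cast this
    omega
  have h := vertexPart_cons_sub_mem t a l hk f
  refine Submodule.span_le (p := LinearMap.ker (truncate F c).toLinearMap).mpr ?_ h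
  rintro g ⟨b, β, hb, -, -, rfl⟩
  rw [SetLike.mem_coe, LinearMap.mem_ker, vertexWord_cons]
  exact truncate_vertexOp_of_lt t (by omega) _

theorem truncate_prefixSplitPoly_succ (k m : ℕ) {a : ℕ} (ha : 0 < a) (l : List ℕ) :
    truncate F a (prefixSplitPoly t k (m + 1) (a :: l)) =
      X a * truncate F a (prefixSplitPoly t k m l) := by
  have h := vertexPart_cons_sub_mem_ker t a (l.take m) (splitPoly t k (l.drop m)) a le_rfl
  rw [map_sub, sub_eq_zero, truncate_vertexOp_self t ha] at h
  exact h

theorem truncate_prefixSplitPoly_of_lt (k m : ℕ) {c a : ℕ} (h : c < a) (l : List ℕ) :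
    truncate F c (prefixSplitPoly t k m (a :: l)) = 0 := by
  have key : ∀ m, truncate F c (prefixSplitPoly t k (m + 1) (a :: l)) = 0 := by
    intro m
    have h' := vertexPart_cons_sub_mem_ker t a (l.take m) (splitPoly t k (l.drop m)) c h.le
    rw [map_sub, sub_eq_zero, truncate_vertexOp_of_lt t (by omega)] at h'
    exact h'
  rcases m with _ | m
  · rw [prefixSplitPoly_zero, splitPoly_cons]
    exact key _
  · exact key m

theorem IsPartition.tail {a : ℕ} {l : List ℕ} (h : IsPartition (a :: l)) :
    IsPartition l ∧ firstPart l ≤ a := by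
  refine ⟨⟨h.1.of_cons, fun b hb => h.2 b (by simp [hb])⟩, ?_⟩
  rcases l with _ | ⟨b, l⟩
  · exact Nat.zero_le a
  · exact List.rel_of_pairwise_cons h.1 List.mem_cons_self

theorem eq_zero_of_sum_truncate_nil (k a m : ℕ) {S : Finset (List ℕ)} (hS : ∀ l ∈ S, l = [])
    {c : List ℕ → F} (h : ∑ l ∈ S, c l • truncate F a (prefixSplitPoly t k m l) = 0) :
    ∀ l ∈ S, c l = 0 := by
  intro l hl
  have hS' : S = {[]} := by
    ext x
    rw [Finset.mem_singleton]
    exact ⟨hS x, fun hx => by rwa [hx, ← hS l hl]⟩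
  rw [hS', Finset.sum_singleton, prefixSplitPoly_nil, map_one,
    smul_eq_zero_iff_left one_ne_zero] at h
  rw [hS l hl, h]

/-- Truncating further to a - 1 kills all terms with first part a, so the others have zero
coefficients by induction on a. The remaining terms share a factor h_a; cancelling it removes a row,
and induction on the length applies. The prefix length m is needed because removing a row shortens
the first piece. -/
theorem eq_zero_of_sum_truncate_prefixSplitPoly (k n a m : ℕ) (S : Finset (List ℕ))
    (hS : ∀ l ∈ S, IsPartition l ∧ firstPart l ≤ a ∧ l.length ≤ n) (c : List ℕ → F)
    (h : ∑ l ∈ S, c l • truncate F a (prefixSplitPoly t k m l) = 0) : ∀ l ∈ S, c l = 0 := by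
  induction n generalizing a m S c with
  | zero =>
    exact eq_zero_of_sum_truncate_nil t k a m
      (fun l hl => List.length_eq_zero_iff.mp (Nat.le_zero.mp (hS l hl).2.2)) h
  | succ n ihn =>
    induction a generalizing m S c with
    | zero =>
      refine eq_zero_of_sum_truncate_nil t k 0 m (fun l hl => ?_) h
      obtain ⟨h1, h2, -⟩ := hS l hl
      rcases l with _ | ⟨b, l⟩
      · rfl
      · have := h1.2 b (by simp)
        have h2' : b ≤ 0 := h2
        omega
    | succ a iha =>
      have hcons : ∀ l ∈ S.filter (fun l => ¬ firstPart l ≤ a), ∃ l', l = (a + 1) :: l' := by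
        intro l hl
        obtain ⟨hl, hla⟩ := Finset.mem_filter.mp hl
        rcases l with _ | ⟨b, l⟩
        · exact absurd (Nat.zero_le a) hla
        · have h1 : b ≤ a + 1 := (hS _ hl).2.1
          have h2 : ¬ b ≤ a := hla
          exact ⟨l, by rw [show b = a + 1 by omega]⟩
      have hsmall : ∑ l ∈ S, c l • truncate F a (prefixSplitPoly t k m l) = 0 := by
        have h' : truncate F (a + 1) (∑ l ∈ S, c l • prefixSplitPoly t k m l) = 0 := by
          simpa only [map_sum, map_smul] using h
        simpa only [map_sum, map_smul] using truncate_eq_zero_of_succ h'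
      have hvanish : ∑ l ∈ S.filter (fun l => ¬ firstPart l ≤ a),
          c l • truncate F a (prefixSplitPoly t k m l) = 0 := by
        refine Finset.sum_eq_zero fun l hl => ?_
        obtain ⟨l, rfl⟩ := hcons l hl
        rw [truncate_prefixSplitPoly_of_lt t k m a.lt_succ_self, smul_zero]
      rw [← Finset.sum_filter_add_sum_filter_not S (fun l => firstPart l ≤ a), hvanish,
        add_zero] at hsmall
      have h1 := iha m (S.filter (fun l => firstPart l ≤ a)) (fun l hl => by
        rw [Finset.mem_filter] at hl
        exact ⟨(hS l hl.1).1, hl.2, (hS l hl.1).2.2⟩) c hsmall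
      rw [← Finset.sum_filter_add_sum_filter_not S (fun l => firstPart l ≤ a),
        Finset.sum_eq_zero fun l hl => by rw [h1 l hl, zero_smul], zero_add] at h
      -- For m = 0 a new piece of the k-split starts, with k - (a + 1) rows allowed after its first;
      -- otherwise the current prefix loses one row.
      obtain ⟨m', hm'⟩ : ∃ m', ∀ l, truncate F (a + 1) (prefixSplitPoly t k m ((a + 1) :: l)) =
          X (a + 1) * truncate F (a + 1) (prefixSplitPoly t k m' l) := by
        rcases m with _ | m
        · refine ⟨k - (a + 1), fun l => ?_⟩
          rw [prefixSplitPoly_zero, splitPoly_cons, truncate_prefixSplitPoly_succ t k _ a.succ_pos]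
        · exact ⟨m, truncate_prefixSplitPoly_succ t k m a.succ_pos⟩
      have h2 := ihn (a + 1) m' ((S.filter fun l => ¬ firstPart l ≤ a).image List.tail)
        (fun l hl => by
          obtain ⟨l', hl', rfl⟩ := Finset.mem_image.mp hl
          obtain ⟨l, rfl⟩ := hcons l' hl'
          obtain ⟨e1, -, e3⟩ := hS _ (Finset.mem_filter.mp hl').1
          exact ⟨e1.tail.1, e1.tail.2, Nat.le_of_succ_le_succ e3⟩)
        (fun l => c ((a + 1) :: l)) (by
          refine mul_left_cancel₀ (X_ne_zero (a + 1)) ?_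
          rw [mul_zero, Finset.mul_sum, Finset.sum_image, ← h]
          · refine Finset.sum_congr rfl fun l hl => ?_
            obtain ⟨l, rfl⟩ := hcons l hl
            rw [List.tail_cons, mul_smul_comm, hm']
          · intro l hl l' hl' e
            obtain ⟨l, rfl⟩ := hcons l hl
            obtain ⟨l', rfl⟩ := hcons l' hl'
            rw [List.tail_cons, List.tail_cons] at e
            rw [e])
      intro l hl
      by_cases hla : firstPart l ≤ a
      · exact h1 l (Finset.mem_filter.mpr ⟨hl, hla⟩)
      · have hl' : l ∈ S.filter (fun l => ¬ firstPart l ≤ a) := Finset.mem_filter.mpr ⟨hl, hla⟩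
        obtain ⟨l, rfl⟩ := hcons l hl'
        exact h2 l (Finset.mem_image.mpr ⟨_, hl', rfl⟩)

theorem linearIndependent_splitPoly (k : ℕ) :
    LinearIndependent F fun l : {l : List ℕ // IsBounded k l} =>
      (⟨splitPoly t k l, splitPoly_mem_boundedSpace t l.2⟩ : boundedSpace t k) := by
  refine LinearIndependent.of_comp (boundedSpace t k).subtype ?_
  change LinearIndepOn F (splitPoly t k) {l | IsBounded k l}
  refine linearIndepOn_iff'.mpr fun S c hS h => ?_
  refine eq_zero_of_sum_truncate_prefixSplitPoly t k (S.sup List.length) k 0 S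
    (fun l hl => ⟨(hS hl).1, (hS hl).2, Finset.le_sup (f := List.length) hl⟩) c ?_
  simp only [prefixSplitPoly_zero]
  simpa only [map_sum, map_smul, map_zero] using congrArg (truncate F k) h

/-- By independence the values on the G_λ can be prescribed on their span, and a linear map on a
subspace extends to the whole space. -/
theorem exists_isProjection (k j : ℕ) : ∃ T, IsProjection t k j T := by
  have hli := linearIndependent_splitPoly t k
  let w : {l : List ℕ // IsBounded k l} → boundedSpace t k := fun l =>
    if firstPart l = j then ⟨splitPoly t k l, splitPoly_mem_boundedSpace t l.2⟩ else 0
  obtain ⟨T, hT⟩ := LinearMap.exists_extend (Finsupp.linearCombination F w ∘ₗ hli.repr)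
  refine ⟨T, fun l hl g hg => ?_⟩
  obtain rfl : g = ⟨splitPoly t k l, splitPoly_mem_boundedSpace t hl⟩ := Subtype.ext hg
  have hmem := Submodule.subset_span (R := F) (Set.mem_range_self (f := fun l :
    {l : List ℕ // IsBounded k l} =>
      (⟨splitPoly t k l, splitPoly_mem_boundedSpace t l.2⟩ : boundedSpace t k)) ⟨l, hl⟩)
  have h := LinearMap.congr_fun hT ⟨_, hmem⟩
  rw [LinearMap.comp_apply, LinearMap.comp_apply, hli.repr_eq_single ⟨l, hl⟩ _ rfl,
    Finsupp.linearCombination_single, one_smul] at h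
  exact h

theorem projection_isProjection (k j : ℕ) : IsProjection t k j (projection t k j) := by
  rw [projection, dif_pos (exists_isProjection t k j)]
  exact (exists_isProjection t k j).choose_spec

theorem projection_eq_zero {k j : ℕ} (g : boundedSpace t k)
    (hg : (g : SymFun F) ∈ splitSpan t k (j + 1)) : projection t k j g = 0 := by
  have h : splitSpan t k (j + 1) ≤
      (LinearMap.ker (projection t k j)).map (boundedSpace t k).subtype := by
    refine Submodule.span_le.mpr ?_
    rintro f ⟨l, hl, hj, rfl⟩
    refine ⟨⟨splitPoly t k l, splitPoly_mem_boundedSpace t hl⟩, ?_, rfl⟩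
    rw [SetLike.mem_coe, LinearMap.mem_ker, projection_isProjection t k j l hl _ rfl,
      if_neg (by omega)]
  obtain ⟨g', hg', e⟩ := h hg
  rwa [Subtype.ext e] at hg'

theorem vertexPart_one_mem_boundedSpace {k : ℕ} {l : List ℕ}
    (hk : ∀ x ∈ l, (x : ℤ) + l.length ≤ (k : ℤ) + 1) : vertexPart t l 1 ∈ boundedSpace t k := by
  rw [← sub_add_cancel (vertexPart t l 1) (vertexWord t (l.map Nat.cast) 1)]
  refine Submodule.add_mem _ (upperSpan_le_boundedSpace t k _
    (vertexPart_sub_mem_upperSpan t l hk 1)) (vertexWord_one_mem_boundedSpace t _ fun x hx => ?_)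
  obtain ⟨y, hy, rfl⟩ := List.mem_map.mp hx
  have := hk y hy
  have := List.length_pos_of_mem hy
  omega

theorem kSchur_eq_vertexPart {k : ℕ} {l : List ℕ} (hl : IsBounded k l) (hook : mainHook l ≤ k) :
    kSchur t k l = vertexPart t l 1 := by
  induction l with
  | nil => rw [kSchur, vertexPart_nil]
  | cons a l ih =>
    have ha := hl.1.2 a (by simp)
    have hook' : a - 1 + l.length + 1 ≤ k := hook
    have htail := hl.1.tail
    have hak : a ≤ k := hl.2
    have hhook : mainHook l ≤ k := by
      rcases l with _ | ⟨b, l⟩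
      · exact Nat.zero_le k
      · have : b ≤ a := htail.2
        rw [mainHook]
        rw [List.length_cons] at hook'
        omega
    have hk := add_length_le_of_mainHook_le hl.1 hook
    -- The hook condition gives ℓ(l) ≤ k - a, so the first piece of the k-split already takes every
    -- row.
    have hsplit : splitPoly t k (a :: l) = vertexPart t (a :: l) 1 := by
      rw [splitPoly, kSplit, genSchur, List.take_of_length_le (by omega),
        List.drop_eq_nil_of_le (by omega), kSplit, genSchur]
    have hs : vertexPart t (a :: l) 1 ∈ boundedSpace t k := vertexPart_one_mem_boundedSpace t hk
    have hd := vertexPart_cons_sub_mem t a l hk 1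
    -- The error words start with a letter above a, so they straighten into split polynomials that
    -- the projection for a kills.
    have hd' : vertexPart t (a :: l) 1 - vertexOp t a (vertexPart t l 1) ∈
        splitSpan t k (a + 1) := by
      refine Submodule.span_le.mpr ?_ hd
      rintro g ⟨b, β, hab, -, hβk, rfl⟩
      exact vertexWord_one_mem_splitSpan t _ hβk hab
    have hd'' : vertexPart t (a :: l) 1 - vertexOp t a (vertexPart t l 1) ∈ boundedSpace t k := by
      refine Submodule.span_le.mpr ?_ hd
      rintro g ⟨b, β, -, -, hβk, rfl⟩
      exact vertexWord_one_mem_boundedSpace t _ hβk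
    have hv : vertexOp t a (vertexPart t l 1) ∈ boundedSpace t k := by
      rw [← sub_sub_cancel (vertexPart t (a :: l) 1) (vertexOp t a (vertexPart t l 1))]
      exact Submodule.sub_mem _ hs hd''
    have hdecomp : (⟨vertexOp t a (vertexPart t l 1), hv⟩ : boundedSpace t k) =
        ⟨vertexPart t (a :: l) 1, hs⟩ - ⟨_, hd''⟩ :=
      Subtype.ext (sub_sub_cancel _ _).symm
    have hp1 := projection_isProjection t k a (a :: l) hl ⟨vertexPart t (a :: l) 1, hs⟩ hsplit.symm
    rw [if_pos (show firstPart (a :: l) = a from rfl)] at hp1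
    have ihl := ih ⟨htail.1, htail.2.trans hak⟩ hhook
    rw [kSchur, ihl, dif_pos hv, hdecomp, map_sub, hp1, projection_eq_zero t ⟨_, hd''⟩ hd',
      sub_zero]

end Independence

end KSchur

/-- Over the field `K(t)` of rational functions: if `λ` is a `k`-bounded partition with main
hook-length at most `k`, then the `k`-Schur function of `λ` is the Schur function of `λ`. -/
theorem mainTheorem3 (K : Type*) [Field K] [CharZero K] (k : ℕ) (l : List ℕ)
    (hl : KSchur.IsBounded k l) (hook : KSchur.mainHook l ≤ k) :
    KSchur.kSchur (RatFunc.X : RatFunc K) k l = KSchur.schur (RatFunc K) l := by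
  have : CharZero (RatFunc K) := charZero_of_injective_algebraMap (algebraMap K (RatFunc K)).injective
  rw [KSchur.kSchur_eq_vertexPart _ hl hook, KSchur.vertexPart_one]
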